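/- Let $L\ge 1$, let $\sigma\in C_b^3(\mathbb R)$ (that is, $\sigma$ is $C^3$ and $\sigma,\sigma',\sigma'',\sigma'''$ are bounded), let $C_W,c_b>0$, and let $\mu$ be a probability measure on $\mathbb R$ with mean $0$, variance $1$ and finite third absolute moment. For widths $n_0,\dots,n_{L+1}\ge 1$ let $W^{(\ell)}=(w^{(\ell)}_{i,j})$ and $G^{(\ell)}=(g^{(\ell)}_{i,j})$ be random $n_\ell\times n_{\ell-1}$ matrices and $b^{(\ell)}$ random vectors in $\mathbb R^{n_\ell}$, $\ell=1,\dots,L+1$, all of whose entries are jointly independent, such that $w^{(1)}_{i,j}\sim\mathcal N(0,C_W/n_0)$; for $\ell\ge 2$, $w^{(\ell)}_{i,j}$ has the law of $\sqrt{C_W/n_{\ell-1}}\,\xi$ with $\xi\sim\mu$; $g^{(\ell)}_{i,j}\sim\mathcal N(0,C_W/n_{\ell-1})$; and $b^{(\ell)}\sim\mathcal N(0,c_b I_{n_\ell})$. For $x\in\mathbb R^{n_0}$ and $m\in\{1,\dots,L+1\}$ let $z^{(L+1;m)}(x)\in\mathbb R^{n_{L+1}}$ be the output of the fully connected network with weights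 $\tilde W^{(\ell)}=W^{(\ell)}$ for $\ell\le m$ and $\tilde W^{(\ell)}=G^{(\ell)}$ for $\ell>m$, i.e. $z^{(L+1;m)}(x)=z^{(L+1)}$, where $$z^{(1)}=\tilde W^{(1)}x+b^{(1)},\qquad z^{(\ell)}=\tilde W^{(\ell)}\sigma(z^{(\ell-1)})+b^{(\ell)}\quad(\ell=2,\dots,L+1),$$ and $\sigma$ acts componentwise. Then there is a constant $C>0$, depending only on $L$, $n_{L+1}$, $\sigma$, $\mu$, $C_W$ and $c_b$, such that for all widths $n_0,\dots,n_L\geq 1$, all such random weights and biases, all $x\in\mathbb R^{n_0}$ and all $K\in\{-1,\dots,L-2\}$ the following holds. For every $F\in L^\infty(\mathbb R^{n_{L+1}})$ the random variables $F(z^{(L+1;L-K)}(x))$ and $F(z^{(L+1;L-K-1)}(x))$ are integrable and $$\Bigl|\mathbb E\bigl[F(z^{(L+1;L-K)}(x))\bigr]-\mathbb E\bigl[F(z^{(L+1;L-K-1)}(x))\bigr]\Bigr|\le \frac{C\,\|F\|_\infty}{\sqrt{n_{L-K-1}}},$$ and for every $F\in C_b^1(\mathbb R^{n_{L+1}})$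 (that is, $F$ is $C^1$ and $F$, $\nabla F$ are bounded) they are integrable and $$\Bigl|\mathbb E\bigl[F(z^{(L+1;L-K)}(x))\bigr]-\mathbb E\bigl[F(z^{(L+1;L-K-1)}(x))\bigr]\Bigr|\le \frac{C\,\|\nabla F\|_\infty}{\sqrt{n_{L-K-1}}},$$ where $\|\nabla F\|_\infty=\sup_y|\nabla F(y)|$ with $|\cdot|$ the Euclidean norm. -/

import Mathlib

open MeasureTheory ProbabilityTheory
open scoped NNReal ENNReal Matrix Gradient

/-- `f ∈ C_b^k`: `f` is `k` times continuously differentiable, and `f` together with all its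
derivatives up to order `k` is bounded. -/
def IsCb {E : Type*} [NormedAddCommGroup E] [NormedSpace ℝ E] (k : ℕ) (f : E → ℝ) : Prop :=
  ContDiff ℝ k f ∧ ∀ i ≤ k, ∃ B : ℝ, ∀ x, ‖iteratedFDeriv ℝ i f x‖ ≤ B

/-- The fully connected network with widths `n 0, n 1, …`, activation `σ` and input `x`.
`W ℓ` and `b ℓ` are the weights and biases of layer `ℓ + 1`, and `networkLayer n σ W b x ℓ` is
`z^{(ℓ+1)}(x)`: `z^{(1)} = W^{(1)} x + b^{(1)}` and
`z^{(ℓ)} = W^{(ℓ)} σ(z^{(ℓ-1)}) + b^{(ℓ)}` for `ℓ ≥ 2`. -/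
def networkLayer (n : ℕ → ℕ) (σ : ℝ → ℝ)
    (W : (ℓ : ℕ) → Matrix (Fin (n (ℓ + 1))) (Fin (n ℓ)) ℝ)
    (b : (ℓ : ℕ) → Fin (n (ℓ + 1)) → ℝ) (x : Fin (n 0) → ℝ) :
    (ℓ : ℕ) → Fin (n (ℓ + 1)) → ℝ
  | 0 => W 0 *ᵥ x + b 0
  | ℓ + 1 => W (ℓ + 1) *ᵥ (fun j => σ (networkLayer n σ W b x ℓ j)) + b (ℓ + 1)

/-- The random output `z^{(L+1; m)}(x)`, as a function of the sample point `ω`: layers `1, …, m`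
use the weights `w`, layers `m + 1, …, L + 1` use the weights `g`, and all layers use the
biases `b`. (Index `ℓ` stands for layer `ℓ + 1`.) -/
def switchedOutput {Ω : Type*} (L : ℕ) (n : ℕ → ℕ) (σ : ℝ → ℝ)
    (w g : (ℓ : ℕ) → Fin (n (ℓ + 1)) → Fin (n ℓ) → Ω → ℝ)
    (b : (ℓ : ℕ) → Fin (n (ℓ + 1)) → Ω → ℝ) (x : Fin (n 0) → ℝ) (m : ℕ) (ω : Ω) :
    EuclideanSpace ℝ (Fin (n (L + 1))) :=
  WithLp.toLp 2 (networkLayer n σ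
    (fun ℓ => Matrix.of fun i j => if ℓ + 1 ≤ m then w ℓ i j ω else g ℓ i j ω)
    (fun ℓ i => b ℓ i ω) x L)

/-- Index set of the entries of the weight matrices of layers `1, …, L + 1`. -/
abbrev WeightIndex (L : ℕ) (n : ℕ → ℕ) : Type :=
  (ℓ : Fin (L + 1)) × (Fin (n (ℓ + 1)) × Fin (n ℓ))

/-- Index set of the entries of the bias vectors of layers `1, …, L + 1`. -/
abbrev BiasIndex (L : ℕ) (n : ℕ → ℕ) : Type :=
  (ℓ : Fin (L + 1)) × Fin (n (ℓ + 1))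

/-- `w` are the weights of the network, `g` the Gaussian weights used for the replacement, and
`b` the Gaussian biases (index `ℓ ≤ L` stands for layer `ℓ + 1`). Only layers `1, …, L + 1`
are constrained. -/
structure IsRandomInit {Ω : Type*} [MeasurableSpace Ω] (P : Measure Ω) (L : ℕ) (n : ℕ → ℕ)
    (CW cb : ℝ≥0) (μ : Measure ℝ)
    (w g : (ℓ : ℕ) → Fin (n (ℓ + 1)) → Fin (n ℓ) → Ω → ℝ)
    (b : (ℓ : ℕ) → Fin (n (ℓ + 1)) → Ω → ℝ) : Prop where
  /-- The first layer has Gaussian weights of variance `CW / n 0`. -/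
  law_first : ∀ i j, HasLaw (w 0 i j) (gaussianReal 0 (CW / n 0)) P
  /-- The later weights have the law of `√(CW / n ℓ) * ξ`, where `ξ` has law `μ`. -/
  law_weight : ∀ ℓ, 1 ≤ ℓ → ℓ ≤ L → ∀ i j,
    HasLaw (w ℓ i j) (μ.map fun t => √((CW : ℝ) / n ℓ) * t) P
  /-- The replacement weights are centred Gaussian with variance `CW / n ℓ`. -/
  law_gauss : ∀ ℓ ≤ L, ∀ i j, HasLaw (g ℓ i j) (gaussianReal 0 (CW / n ℓ)) P
  /-- The biases are centred Gaussian with variance `cb`. -/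
  law_bias : ∀ ℓ ≤ L, ∀ i, HasLaw (b ℓ i) (gaussianReal 0 cb) P
  /-- All entries of all weights, replacement weights and biases are jointly independent. -/
  indep : iIndepFun
    (Sum.elim (fun p : WeightIndex L n => w p.1 p.2.1 p.2.2)
      (Sum.elim (fun p : WeightIndex L n => g p.1 p.2.1 p.2.2)
        (fun p : BiasIndex L n => b p.1 p.2))) P

/-! The two networks agree up to the layer whose weights are exchanged and have Gaussian weights
after it. Given the preceding layer, of width `n`, the neurons of the exchanged layer are
independent, each a weighted sum of iid weights plus a Gaussian bias
(`IsIndepNetwork.integral_layer_succ`). Lindeberg's method exchanges the weights of one neuron one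
at a time. Laws with the same mean and variance cannot be told apart by the second order Taylor
polynomial of the test function, so each exchange costs a third moment of order `n ^ (-3/2)`, and
the `n` weights of a neuron cost order `1 / √n` (`abs_integral_pi_lindeberg`).

Two points need more: the test function must be smooth although `F` need not be, and the number of
neurons in an exchanged hidden layer must not enter the bound.

If the exchanged layer is hidden, every later layer is, given the one before it, a Gaussian vector
with iid centred coordinates of variance `layerVar`, which is `cb` plus an empirical mean of `σ ^
2`. The mean of `F` given the last hidden layer is therefore a function `gaussAvg F` of one scalar.
It is smooth because Gaussian densities are smooth in the variance, which is at least `cb > 0`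
(`smoothBdd_gaussAvg`). Each earlier Gaussian layer turns `Φ` into the Gaussian mean of `Φ ∘
layerVar`, smooth again, with bounds free of the width (`smoothBdd_gaussAvg_comp_layerVar`). A
neuron of the exchanged layer has a share of one over the width in `layerVar`, and so has its
exchange in the error (`taylorThree_comp_layerVar`); summing over the neurons cancels the width.

If the exchanged layer is the output, convolution with the Gaussian bias provides the smoothness
(`taylorThree_gaussian_smoothing`), and the constant may depend on the output dimension.

Both classes of `F` enter only through `|F y - F y'| ≤ A * (1 + ∑ i, |y i - y' i|)`, where `A` is
twice the sup norm or the sup of the gradient. -/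

/-! ### Functions with three bounded derivatives -/

/-- `f1`, `f2`, `f3` are the first three derivatives of `f` on `I`. -/
structure HasJet (I : Set ℝ) (f f1 f2 f3 : ℝ → ℝ) : Prop where
  d1 : ∀ x ∈ I, HasDerivAt f (f1 x) x
  d2 : ∀ x ∈ I, HasDerivAt f1 (f2 x) x
  d3 : ∀ x ∈ I, HasDerivAt f2 (f3 x) x

namespace HasJet

variable {I J : Set ℝ} {f f1 f2 f3 g g1 g2 g3 : ℝ → ℝ}

theorem comp (hf : HasJet J f f1 f2 f3) (hg : HasJet I g g1 g2 g3) (h : Set.MapsTo g I J) :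
    HasJet I (fun x => f (g x)) (fun x => f1 (g x) * g1 x)
      (fun x => f2 (g x) * g1 x ^ 2 + f1 (g x) * g2 x)
      (fun x => f3 (g x) * g1 x ^ 3 + 3 * f2 (g x) * g1 x * g2 x + f1 (g x) * g3 x) where
  d1 x hx := (hf.d1 _ (h hx)).comp x (hg.d1 x hx)
  d2 x hx := by
    have h1 := ((hf.d2 _ (h hx)).comp x (hg.d1 x hx)).mul (hg.d2 x hx)
    refine h1.congr_deriv ?_
    simp only [Function.comp]
    ring
  d3 x hx := by
    have h1 := (((hf.d3 _ (h hx)).comp x (hg.d1 x hx)).mul ((hg.d2 x hx).pow 2)).add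
      (((hf.d2 _ (h hx)).comp x (hg.d1 x hx)).mul (hg.d3 x hx))
    refine h1.congr_deriv ?_
    simp only [Function.comp, Pi.pow_apply]
    push_cast
    ring

theorem const_mul (c : ℝ) (hf : HasJet I f f1 f2 f3) :
    HasJet I (fun x => c * f x) (fun x => c * f1 x) (fun x => c * f2 x) (fun x => c * f3 x) where
  d1 x hx := (hf.d1 x hx).const_mul c
  d2 x hx := (hf.d2 x hx).const_mul c
  d3 x hx := (hf.d3 x hx).const_mul c

theorem mul_const (c : ℝ) (hf : HasJet I f f1 f2 f3) :
    HasJet I (fun x => f x * c) (fun x => f1 x * c) (fun x => f2 x * c) (fun x => f3 x * c) where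
  d1 x hx := (hf.d1 x hx).mul_const c
  d2 x hx := (hf.d2 x hx).mul_const c
  d3 x hx := (hf.d3 x hx).mul_const c

theorem const_add (c : ℝ) (hf : HasJet I f f1 f2 f3) :
    HasJet I (fun x => c + f x) f1 f2 f3 where
  d1 x hx := (hf.d1 x hx).const_add c
  d2 x hx := hf.d2 x hx
  d3 x hx := hf.d3 x hx

theorem sum {ι : Type*} (s : Finset ι) {f f1 f2 f3 : ι → ℝ → ℝ}
    (hf : ∀ i ∈ s, HasJet I (f i) (f1 i) (f2 i) (f3 i)) :
    HasJet I (fun x => ∑ i ∈ s, f i x) (fun x => ∑ i ∈ s, f1 i x) (fun x => ∑ i ∈ s, f2 i x)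
      (fun x => ∑ i ∈ s, f3 i x) where
  d1 x hx := HasDerivAt.fun_sum fun i hi => (hf i hi).d1 x hx
  d2 x hx := HasDerivAt.fun_sum fun i hi => (hf i hi).d2 x hx
  d3 x hx := HasDerivAt.fun_sum fun i hi => (hf i hi).d3 x hx

theorem mono (hf : HasJet J f f1 f2 f3) (h : I ⊆ J) : HasJet I f f1 f2 f3 where
  d1 x hx := hf.d1 x (h hx)
  d2 x hx := hf.d2 x (h hx)
  d3 x hx := hf.d3 x (h hx)

theorem to_deriv (hI : IsOpen I) (hf : HasJet I f f1 f2 f3) :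
    HasJet I f (deriv f) (deriv (deriv f)) (deriv (deriv (deriv f))) ∧
      ∀ x ∈ I, deriv f x = f1 x ∧ deriv (deriv f) x = f2 x ∧ deriv (deriv (deriv f)) x = f3 x := by
  have e1 : ∀ x ∈ I, deriv f x = f1 x := fun x hx => (hf.d1 x hx).deriv
  have d2 : ∀ x ∈ I, HasDerivAt (deriv f) (f2 x) x := fun x hx =>
    (hf.d2 x hx).congr_of_eventuallyEq (Filter.eventuallyEq_of_mem (hI.mem_nhds hx) e1)
  have e2 : ∀ x ∈ I, deriv (deriv f) x = f2 x := fun x hx => (d2 x hx).deriv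
  have d3 : ∀ x ∈ I, HasDerivAt (deriv (deriv f)) (f3 x) x := fun x hx =>
    (hf.d3 x hx).congr_of_eventuallyEq (Filter.eventuallyEq_of_mem (hI.mem_nhds hx) e2)
  have e3 : ∀ x ∈ I, deriv (deriv (deriv f)) x = f3 x := fun x hx => (d3 x hx).deriv
  refine ⟨⟨fun x hx => ?_, fun x hx => ?_, fun x hx => ?_⟩, fun x hx => ⟨e1 x hx, e2 x hx, e3 x hx⟩⟩
  · rw [e1 x hx]; exact hf.d1 x hx
  · rw [e2 x hx]; exact d2 x hx
  · rw [e3 x hx]; exact d3 x hx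

end HasJet

theorem abs_sub_le_of_hasDerivAt_uIcc {g g' : ℝ → ℝ} {x y C : ℝ}
    (h : ∀ u ∈ Set.uIcc x y, HasDerivAt g (g' u) u) (hC : ∀ u ∈ Set.uIcc x y, |g' u| ≤ C) :
    |g y - g x| ≤ C * |y - x| :=
  (convex_uIcc x y).norm_image_sub_le_of_norm_hasDerivWithin_le
    (fun u hu => (h u hu).hasDerivWithinAt) hC Set.left_mem_uIcc Set.right_mem_uIcc

/-- The mean value inequality is applied three times, to `f2`, `f1` and `f` minus their Taylor
polynomials. This gives `M` instead of the sharp `M / 6`, which is all that is needed. -/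
theorem HasJet.taylor {I : Set ℝ} {f f1 f2 f3 : ℝ → ℝ} (hf : HasJet I f f1 f2 f3) {M x t : ℝ}
    (hI : Set.uIcc x (x + t) ⊆ I) (hM : ∀ u ∈ I, |f3 u| ≤ M) :
    |f (x + t) - f x - f1 x * t - f2 x / 2 * t ^ 2| ≤ M * |t| ^ 3 := by
  have hM0 : 0 ≤ M := (abs_nonneg _).trans (hM x (hI Set.left_mem_uIcc))
  have hsub : ∀ u ∈ Set.uIcc x (x + t), |u - x| ≤ |t| := fun u hu => by
    simpa using Set.abs_sub_left_of_mem_uIcc hu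
  have hsub2 : ∀ u ∈ Set.uIcc x (x + t), Set.uIcc x u ⊆ Set.uIcc x (x + t) := fun u hu =>
    Set.uIcc_subset_uIcc Set.left_mem_uIcc hu
  have b2 : ∀ u ∈ Set.uIcc x (x + t), |f2 u - f2 x| ≤ M * |t| := fun u hu =>
    (abs_sub_le_of_hasDerivAt_uIcc (fun v hv => hf.d3 v (hI (hsub2 u hu hv)))
      (fun v hv => hM v (hI (hsub2 u hu hv)))).trans (mul_le_mul_of_nonneg_left (hsub u hu) hM0)
  have b1 : ∀ u ∈ Set.uIcc x (x + t), |f1 u - f1 x - f2 x * (u - x)| ≤ M * |t| ^ 2 := fun u hu => by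
    have := abs_sub_le_of_hasDerivAt_uIcc (g := fun v => f1 v - f2 x * (v - x))
      (g' := fun v => f2 v - f2 x) (x := x) (y := u) (C := M * |t|)
      (fun v hv => ((hf.d2 v (hI (hsub2 u hu hv))).sub
        (((hasDerivAt_id v).sub_const x).const_mul (f2 x))).congr_deriv (by simp))
      (fun v hv => b2 v (hsub2 u hu hv))
    calc |f1 u - f1 x - f2 x * (u - x)|
        = |(f1 u - f2 x * (u - x)) - (f1 x - f2 x * (x - x))| := by congr 1; ring
      _ ≤ M * |t| * |u - x| := this
      _ ≤ M * |t| * |t| := mul_le_mul_of_nonneg_left (hsub u hu) (by positivity)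
      _ = _ := by ring
  have := abs_sub_le_of_hasDerivAt_uIcc
      (g := fun v => f v - f1 x * (v - x) - f2 x / 2 * (v - x) ^ 2)
      (g' := fun v => f1 v - f1 x - f2 x * (v - x)) (x := x) (y := x + t) (C := M * |t| ^ 2)
      (fun v hv => (((hf.d1 v (hI hv)).sub
        (((hasDerivAt_id v).sub_const x).const_mul (f1 x))).sub
        ((((hasDerivAt_id v).sub_const x).pow 2).const_mul (f2 x / 2))).congr_deriv
          (by simp; ring)) b1
  calc |f (x + t) - f x - f1 x * t - f2 x / 2 * t ^ 2|
      = |(f (x + t) - f1 x * (x + t - x) - f2 x / 2 * (x + t - x) ^ 2)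
          - (f x - f1 x * (x - x) - f2 x / 2 * (x - x) ^ 2)| := by congr 1; ring
    _ ≤ M * |t| ^ 2 * |x + t - x| := this
    _ = _ := by rw [add_sub_cancel_left]; ring

/-- `f` is three times differentiable on `I`, with first three derivatives bounded by `M`. -/
def SmoothBdd (I : Set ℝ) (f : ℝ → ℝ) (M : ℝ) : Prop :=
  ∃ f1 f2 f3 : ℝ → ℝ, HasJet I f f1 f2 f3 ∧ ∀ x ∈ I, |f1 x| ≤ M ∧ |f2 x| ≤ M ∧ |f3 x| ≤ M

/-- On an open set the derivatives can be taken to be iterated `deriv`, which are measurable on all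
of `ℝ`. This allows integrating them along random arguments. -/
theorem SmoothBdd.measurable_jet {I : Set ℝ} {f : ℝ → ℝ} {M : ℝ} (hI : IsOpen I)
    (hf : SmoothBdd I f M) :
    ∃ f1 f2 f3 : ℝ → ℝ, HasJet I f f1 f2 f3 ∧ (∀ x ∈ I, |f1 x| ≤ M ∧ |f2 x| ≤ M ∧ |f3 x| ≤ M) ∧
      Measurable f1 ∧ Measurable f2 ∧ Measurable f3 := by
  obtain ⟨f1, f2, f3, hj, hb⟩ := hf
  obtain ⟨hj', he⟩ := hj.to_deriv hI
  refine ⟨_, _, _, hj', fun x hx => ?_, measurable_deriv _, measurable_deriv _, measurable_deriv _⟩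
  obtain ⟨e1, e2, e3⟩ := he x hx
  rw [e1, e2, e3]
  exact hb x hx

/-- The three quantities are the derivatives of a composition in `HasJet.comp`. The factor `5 = 1 +
3 + 1` adds the coefficients of the third one, and `1 ≤ a` lets `a ^ 3` dominate the lower powers.
-/
theorem abs_jet_comp_le {M a p1 p2 p3 q1 q2 q3 : ℝ} (ha : 1 ≤ a) (h1 : |p1| ≤ M) (h2 : |p2| ≤ M)
    (h3 : |p3| ≤ M) (k1 : |q1| ≤ a) (k2 : |q2| ≤ a) (k3 : |q3| ≤ a) :
    |p1 * q1| ≤ 5 * M * a ^ 3 ∧ |p2 * q1 ^ 2 + p1 * q2| ≤ 5 * M * a ^ 3 ∧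
      |p3 * q1 ^ 3 + 3 * p2 * q1 * q2 + p1 * q3| ≤ 5 * M * a ^ 3 := by
  have hM : 0 ≤ M := (abs_nonneg _).trans h1
  have a0 : 0 ≤ a := by linarith
  have ha2 : a ^ 2 ≤ a ^ 3 := pow_le_pow_right₀ ha (by norm_num)
  have ha1 : a ≤ a ^ 3 := le_self_pow₀ ha (by norm_num)
  have e1 : M * a ≤ M * a ^ 3 := by gcongr
  have e2 : M * a ^ 2 ≤ M * a ^ 3 := by gcongr
  have e3 : 0 ≤ M * a ^ 3 := by positivity
  have t1 : |p1 * q1| ≤ M * a := by rw [abs_mul]; gcongr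
  have t2 : |p1 * q2| ≤ M * a := by rw [abs_mul]; gcongr
  have t3 : |p1 * q3| ≤ M * a := by rw [abs_mul]; gcongr
  have t4 : |p2 * q1 ^ 2| ≤ M * a ^ 2 := by rw [abs_mul, abs_pow]; gcongr
  have t5 : |p3 * q1 ^ 3| ≤ M * a ^ 3 := by rw [abs_mul, abs_pow]; gcongr
  have t6 : |3 * p2 * q1 * q2| ≤ 3 * (M * a ^ 2) := by
    rw [abs_mul, abs_mul, abs_mul, abs_of_pos (by norm_num : (0:ℝ) < 3)]
    calc 3 * |p2| * |q1| * |q2| ≤ 3 * M * a * a := by gcongr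
      _ = _ := by ring
  refine ⟨by linarith, (abs_add_le _ _).trans (by linarith), (abs_add_le _ _).trans ?_⟩
  have := abs_add_le (p3 * q1 ^ 3) (3 * p2 * q1 * q2)
  linarith

theorem hasDerivAt_integral_of_abs_le {Y : Type*} [MeasurableSpace Y] {κ : Measure Y} {I : Set ℝ}
    (hI : IsOpen I) {p p1 : ℝ → Y → ℝ} {D : Y → ℝ}
    (hj : ∀ y, ∀ θ ∈ I, HasDerivAt (fun θ => p θ y) (p1 θ y) θ)
    (hp : ∀ θ ∈ I, Integrable (p θ) κ) (hm : ∀ θ ∈ I, AEStronglyMeasurable (p1 θ) κ)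
    (hD : Integrable D κ) (hb : ∀ θ ∈ I, ∀ y, |p1 θ y| ≤ D y) :
    ∀ θ ∈ I, Integrable (p1 θ) κ ∧
      HasDerivAt (fun θ => ∫ y, p θ y ∂κ) (∫ y, p1 θ y ∂κ) θ := fun θ hθ =>
  hasDerivAt_integral_of_dominated_loc_of_deriv_le (hI.mem_nhds hθ)
    (Filter.eventually_of_mem (hI.mem_nhds hθ) fun θ' h' => (hp θ' h').aestronglyMeasurable)
    (hp θ hθ) (hm θ hθ) (.of_forall fun y θ' h' => hb θ' h' y) hD
    (.of_forall fun y θ' h' => hj y θ' h')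

/-- Differentiation under the integral sign, three times; each round yields the integrability that
the next one requires. Only the derivatives are dominated by `D`, so the size of `p` itself does not
enter the bound. -/
theorem SmoothBdd.integral {Y : Type*} [MeasurableSpace Y] {κ : Measure Y} {I : Set ℝ}
    (hI : IsOpen I) {p p1 p2 p3 : ℝ → Y → ℝ} {D : Y → ℝ}
    (hj : ∀ y, HasJet I (fun θ => p θ y) (fun θ => p1 θ y) (fun θ => p2 θ y) (fun θ => p3 θ y))
    (hp : ∀ θ ∈ I, Integrable (p θ) κ)
    (hm : ∀ θ ∈ I, AEStronglyMeasurable (p1 θ) κ ∧ AEStronglyMeasurable (p2 θ) κ ∧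
      AEStronglyMeasurable (p3 θ) κ)
    (hD : Integrable D κ)
    (hb : ∀ θ ∈ I, ∀ y, |p1 θ y| ≤ D y ∧ |p2 θ y| ≤ D y ∧ |p3 θ y| ≤ D y) :
    SmoothBdd I (fun θ => ∫ y, p θ y ∂κ) (∫ y, D y ∂κ) := by
  have r1 := hasDerivAt_integral_of_abs_le hI (fun y => (hj y).d1) hp (fun θ h => (hm θ h).1) hD
    (fun θ h y => (hb θ h y).1)
  have r2 := hasDerivAt_integral_of_abs_le hI (fun y => (hj y).d2) (fun θ h => (r1 θ h).1)
    (fun θ h => (hm θ h).2.1) hD (fun θ h y => (hb θ h y).2.1)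
  have r3 := hasDerivAt_integral_of_abs_le hI (fun y => (hj y).d3) (fun θ h => (r2 θ h).1)
    (fun θ h => (hm θ h).2.2) hD (fun θ h y => (hb θ h y).2.2)
  refine ⟨_, _, _, ⟨fun θ h => (r1 θ h).2, fun θ h => (r2 θ h).2, fun θ h => (r3 θ h).2⟩,
    fun θ h => ⟨?_, ?_, ?_⟩⟩
  · exact norm_integral_le_of_norm_le (f := p1 θ) hD (.of_forall fun y => (hb θ h y).1)
  · exact norm_integral_le_of_norm_le (f := p2 θ) hD (.of_forall fun y => (hb θ h y).2.1)
  · exact norm_integral_le_of_norm_le (f := p3 θ) hD (.of_forall fun y => (hb θ h y).2.2)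

/-- `H` has at every point a second order Taylor expansion with error at most `M |t|³`. -/
def TaylorThree (H : ℝ → ℝ) (M : ℝ) : Prop :=
  ∀ x, ∃ c1 c2 : ℝ, ∀ t, |H (x + t) - H x - c1 * t - c2 * t ^ 2| ≤ M * |t| ^ 3

theorem HasJet.taylorThree {f f1 f2 f3 : ℝ → ℝ} (hf : HasJet Set.univ f f1 f2 f3) {M : ℝ}
    (hM : ∀ u, |f3 u| ≤ M) : TaylorThree f M := fun x =>
  ⟨f1 x, f2 x / 2, fun _ => hf.taylor (Set.subset_univ _) fun u _ => hM u⟩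

/-! ### Exchanging the factors of a product measure -/

theorem isProbabilityMeasure_update {ι α : Type*} [DecidableEq ι] [MeasurableSpace α]
    (m : ι → Measure α) [∀ i, IsProbabilityMeasure (m i)] (η : Measure α) [IsProbabilityMeasure η]
    (p i : ι) : IsProbabilityMeasure (Function.update m p η i) := by
  rcases eq_or_ne i p with rfl | h
  · simpa
  · simpa [h] using inferInstanceAs (IsProbabilityMeasure (m i))

theorem measurable_update_prod {ι α : Type*} [DecidableEq ι] [MeasurableSpace α] (p : ι) :
    Measurable (fun x : (ι → α) × α => Function.update x.1 p x.2) := by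
  refine measurable_pi_lambda _ fun i => ?_
  rcases eq_or_ne i p with rfl | h
  · simpa using measurable_snd
  · simp only [Function.update_of_ne h]
    exact (measurable_pi_apply i).comp measurable_fst

/-- Resampling the coordinate `p` from `η` forgets its old value, whose law has total mass one.
Together with Fubini this isolates one coordinate of a product integral. -/
theorem map_update_pi_prod {ι α : Type*} [Fintype ι] [DecidableEq ι] [MeasurableSpace α]
    (m : ι → Measure α) [∀ i, IsProbabilityMeasure (m i)] (η : Measure α) [IsProbabilityMeasure η]
    (p : ι) :
    ((Measure.pi m).prod η).map (fun x => Function.update x.1 p x.2)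
      = Measure.pi (Function.update m p η) := by
  have := isProbabilityMeasure_update m η p
  refine (Measure.pi_eq fun s hs => ?_).symm
  rw [Measure.map_apply (measurable_update_prod p) (.univ_pi hs)]
  have : (fun x : (ι → α) × α => Function.update x.1 p x.2) ⁻¹' (Set.univ.pi s)
      = (Set.univ.pi (Function.update s p Set.univ)) ×ˢ s p := by
    ext x
    simp only [Set.mem_preimage, Set.mem_univ_pi, Set.mem_prod]
    constructor
    · intro h
      refine ⟨fun i => ?_, by simpa using h p⟩
      rcases eq_or_ne i p with rfl | hi
      · simp
      · simpa [hi] using h i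
    · rintro ⟨h1, h2⟩ i
      rcases eq_or_ne i p with rfl | hi
      · simpa using h2
      · simpa [hi] using h1 i
  rw [this, Measure.prod_prod, Measure.pi_pi, mul_comm,
    ← Finset.mul_prod_erase _ _ (Finset.mem_univ p),
    ← Finset.mul_prod_erase (Finset.univ : Finset ι) (fun i => Function.update m p η i (s i))
      (Finset.mem_univ p)]
  simp only [Function.update_self, measure_univ, one_mul]
  congr 1
  refine Finset.prod_congr rfl fun i hi => ?_
  have hi' : i ≠ p := Finset.ne_of_mem_erase hi
  simp [hi']

theorem integrable_of_measurable_of_abs_le {α : Type*} [MeasurableSpace α] {m : Measure α}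
    [IsFiniteMeasure m] {f : α → ℝ} (hf : Measurable f) {B : ℝ} (hB : ∀ x, |f x| ≤ B) :
    Integrable f m :=
  Integrable.of_bound hf.aestronglyMeasurable B (.of_forall hB)

theorem integral_pi_update {ι α : Type*} [Fintype ι] [DecidableEq ι] [MeasurableSpace α]
    (m : ι → Measure α) [∀ i, IsProbabilityMeasure (m i)] (η : Measure α) [IsProbabilityMeasure η]
    (p : ι) {f : (ι → α) → ℝ} (hf : Measurable f) {B : ℝ} (hB : ∀ x, |f x| ≤ B) :
    ∫ x, f x ∂Measure.pi (Function.update m p η)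
      = ∫ a, ∫ t, f (Function.update a p t) ∂η ∂Measure.pi m := by
  rw [← map_update_pi_prod m η p, integral_map (measurable_update_prod p).aemeasurable
    hf.aestronglyMeasurable]
  exact integral_prod _
    (integrable_of_measurable_of_abs_le (hf.comp (measurable_update_prod p)) fun x => hB _)

theorem abs_integral_le_of_abs_le {α : Type*} [MeasurableSpace α] {m : Measure α}
    [IsProbabilityMeasure m] {f : α → ℝ} {B : ℝ} (hB : ∀ x, |f x| ≤ B) : |∫ x, f x ∂m| ≤ B := by
  simpa using norm_integral_le_of_norm_le_const (μ := m) (f := f) (.of_forall hB)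

theorem abs_integral_sub_integral_le {α : Type*} [MeasurableSpace α] {m : Measure α}
    [IsProbabilityMeasure m] {f g : α → ℝ} (hf : Integrable f m) (hg : Integrable g m) {B : ℝ}
    (hB : ∀ x, |f x - g x| ≤ B) : |∫ x, f x ∂m - ∫ x, g x ∂m| ≤ B := by
  rw [← integral_sub hf hg]
  exact abs_integral_le_of_abs_le hB

/-- Replacing the factors of a product measure one after the other. -/
theorem abs_integral_pi_sub_integral_pi_le {ι α : Type*} [Fintype ι] [DecidableEq ι]
    [MeasurableSpace α] (m m' : ι → Measure α) [∀ i, IsProbabilityMeasure (m i)]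
    [∀ i, IsProbabilityMeasure (m' i)] {f : (ι → α) → ℝ} (hf : Measurable f) {B : ℝ}
    (hB : ∀ x, |f x| ≤ B) (ε : ι → ℝ)
    (h : ∀ i a, |∫ t, f (Function.update a i t) ∂(m i)
      - ∫ t, f (Function.update a i t) ∂(m' i)| ≤ ε i) :
    |∫ x, f x ∂Measure.pi m - ∫ x, f x ∂Measure.pi m'| ≤ ∑ i, ε i := by
  have key : ∀ S : Finset ι, |∫ x, f x ∂Measure.pi m
      - ∫ x, f x ∂Measure.pi (fun i => if i ∈ S then m' i else m i)| ≤ ∑ i ∈ S, ε i := by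
    intro S
    induction S using Finset.induction_on with
    | empty => simp
    | insert p S hp ih =>
      set mS : ι → Measure α := fun i => if i ∈ S then m' i else m i with hmS
      have hprob : ∀ i, IsProbabilityMeasure (mS i) := fun i => by
        simp only [hmS]; split_ifs <;> infer_instance
      -- Writing both measures as updates of the same `mS` turns the two integrals into outer
      -- integrals over one common measure, so that they can be compared pointwise.
      have e1 : mS = Function.update mS p (m p) := by
        rw [eq_comm, Function.update_eq_self_iff]; simp [hmS, hp]
      have e2 : (fun i => if i ∈ insert p S then m' i else m i)
          = Function.update mS p (m' p) := by
        ext1 i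
        rcases eq_or_ne i p with rfl | hi
        · simp
        · simp [hi, hmS]
      have hmeas : ∀ η : Measure α, IsProbabilityMeasure η →
          Measurable (fun a => ∫ t, f (Function.update a p t) ∂η) := fun η _ =>
        (StronglyMeasurable.integral_prod_right (f := fun a t => f (Function.update a p t))
          (hf.comp (measurable_update_prod p)).stronglyMeasurable).measurable
      have hstep : |∫ x, f x ∂Measure.pi mS
          - ∫ x, f x ∂Measure.pi (fun i => if i ∈ insert p S then m' i else m i)| ≤ ε p := by
        rw [e2, integral_pi_update mS (m' p) p hf hB]
        nth_rw 1 [e1]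
        rw [integral_pi_update mS (m p) p hf hB]
        refine abs_integral_sub_integral_le ?_ ?_ fun a => h p a
        · exact integrable_of_measurable_of_abs_le (hmeas _ inferInstance)
            fun a => abs_integral_le_of_abs_le fun t => hB _
        · exact integrable_of_measurable_of_abs_le (hmeas _ inferInstance)
            fun a => abs_integral_le_of_abs_le fun t => hB _
      rw [Finset.sum_insert hp]
      have := abs_sub_le (∫ x, f x ∂Measure.pi m) (∫ x, f x ∂Measure.pi mS)
        (∫ x, f x ∂Measure.pi (fun i => if i ∈ insert p S then m' i else m i))
      linarith
  simpa using key Finset.univ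

/-! ### Lindeberg's exchange -/

/-- Mean zero, variance one and a finite third absolute moment. -/
structure IsStandard (μ : Measure ℝ) : Prop where
  mean : ∫ t, t ∂μ = 0
  var : ∫ t, t ^ 2 ∂μ = 1
  third : Integrable (fun t : ℝ => |t| ^ 3) μ

theorem IsStandard.integrable {μ : Measure ℝ} [IsProbabilityMeasure μ] (h : IsStandard μ) :
    Integrable (fun t : ℝ => t) μ ∧ Integrable (fun t : ℝ => t ^ 2) μ := by
  constructor
  · refine ((integrable_const (1 : ℝ)).add h.third).mono' measurable_id.aestronglyMeasurable
      (.of_forall fun t => ?_)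
    have := abs_nonneg t
    simp only [Pi.add_apply, Real.norm_eq_abs]
    nlinarith [sq_nonneg (|t| - 1), mul_nonneg this (sq_nonneg (|t| - 1))]
  · refine ((integrable_const (1 : ℝ)).add h.third).mono' (by fun_prop)
      (.of_forall fun t => ?_)
    have := abs_nonneg t
    simp only [Pi.add_apply, Real.norm_eq_abs, abs_pow]
    nlinarith [sq_nonneg (|t| - 1), mul_nonneg this (sq_nonneg (|t| - 1))]

theorem isStandard_gaussianReal : IsStandard (gaussianReal 0 1) where
  mean := integral_id_gaussianReal
  var := by
    have := variance_fun_id_gaussianReal (μ := 0) (v := 1)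
    rw [variance_eq_integral (X := fun x => x) measurable_id.aemeasurable] at this
    simpa using this
  third := by
    have := (memLp_id_gaussianReal (μ := 0) (v := 1) 3).integrable_norm_pow (p := 3) (by norm_num)
    simpa using this

/-- The mean of the quadratic polynomial is `a + c2` for every standardized law, so two such laws
differ only by third moments. -/
theorem IsStandard.abs_integral_sub_quadratic_le {μ : Measure ℝ} [IsProbabilityMeasure μ]
    (h : IsStandard μ) {f : ℝ → ℝ} (hf : Integrable f μ) {a c1 c2 K : ℝ}
    (hK : ∀ t, |f t - a - c1 * t - c2 * t ^ 2| ≤ K * |t| ^ 3) :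
    |∫ t, f t ∂μ - (a + c2)| ≤ K * ∫ t, |t| ^ 3 ∂μ := by
  have i1 : Integrable (fun t => f t - a) μ := hf.sub (integrable_const a)
  have i2 : Integrable (fun t => c1 * t) μ := h.integrable.1.const_mul c1
  have i3 : Integrable (fun t => c2 * t ^ 2) μ := h.integrable.2.const_mul c2
  have e : ∫ t, (f t - a - c1 * t - c2 * t ^ 2) ∂μ = ∫ t, f t ∂μ - (a + c2) := by
    rw [integral_sub (f := fun t => f t - a - c1 * t) (i1.sub i2) i3, integral_sub i1 i2,
      integral_sub hf (integrable_const a), integral_const_mul, integral_const_mul, h.mean, h.var]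
    simp
    ring
  rw [← e, ← integral_const_mul]
  exact norm_integral_le_of_norm_le (f := fun t => f t - a - c1 * t - c2 * t ^ 2)
    (h.third.const_mul K) (.of_forall hK)

theorem abs_integral_pi_lindeberg {ι : Type*} [Fintype ι] {μ ν : Measure ℝ}
    [IsProbabilityMeasure μ] [IsProbabilityMeasure ν] (hμ : IsStandard μ) (hν : IsStandard ν)
    {H : ℝ → ℝ} (hH : Measurable H) {B M S c : ℝ} (hB : ∀ x, |H x| ≤ B) (hT : TaylorThree H M)
    (hM : 0 ≤ M) (hc : 0 ≤ c) (s : ι → ℝ) (hs : ∀ j, |s j| ≤ S) (x : ℝ) :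
    |∫ r, H (x + ∑ j, s j * r j) ∂Measure.pi (fun _ : ι => μ.map fun t => c * t)
      - ∫ r, H (x + ∑ j, s j * r j) ∂Measure.pi (fun _ : ι => ν.map fun t => c * t)|
    ≤ Fintype.card ι * (M * (S * c) ^ 3 * (∫ t, |t| ^ 3 ∂μ + ∫ t, |t| ^ 3 ∂ν)) := by
  classical
  have hcm : Measurable fun t : ℝ => c * t := measurable_const_mul c
  have := Measure.isProbabilityMeasure_map (μ := μ) hcm.aemeasurable
  have := Measure.isProbabilityMeasure_map (μ := ν) hcm.aemeasurable
  have hfm : Measurable fun r : ι → ℝ => H (x + ∑ j, s j * r j) := hH.comp (by fun_prop)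
  refine (abs_integral_pi_sub_integral_pi_le _ _ hfm (fun r => hB _)
    (fun _ => M * (S * c) ^ 3 * (∫ t, |t| ^ 3 ∂μ + ∫ t, |t| ^ 3 ∂ν)) fun i a => ?_).trans
    (by simp)
  -- All summands except the `i`-th are frozen, and the Taylor expansion is taken at their sum `y`.
  set y := x + ∑ j ∈ Finset.univ.erase i, s j * a j with hy
  have hupd : ∀ t, x + ∑ j, s j * Function.update a i t j = y + s i * t := fun t => by
    rw [← Finset.add_sum_erase _ _ (Finset.mem_univ i), hy, Function.update_self]
    have : ∑ j ∈ Finset.univ.erase i, s j * Function.update a i t j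
        = ∑ j ∈ Finset.univ.erase i, s j * a j :=
      Finset.sum_congr rfl fun j hj => by simp [Finset.ne_of_mem_erase hj]
    rw [this]; ring
  simp only [hupd]
  have hym : Measurable fun t => H (y + s i * t) := hH.comp (by fun_prop)
  rw [integral_map hcm.aemeasurable hym.aestronglyMeasurable,
    integral_map hcm.aemeasurable hym.aestronglyMeasurable]
  obtain ⟨c1, c2, hT⟩ := hT y
  have hK : ∀ t, |H (y + s i * (c * t)) - H y - c1 * (s i * c) * t - c2 * (s i * c) ^ 2 * t ^ 2|
      ≤ M * (S * c) ^ 3 * |t| ^ 3 := fun t => by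
    have h1 := hT (s i * (c * t))
    have h2 : |s i * (c * t)| ≤ S * c * |t| := by
      rw [abs_mul, abs_mul, abs_of_nonneg hc, mul_assoc]
      exact mul_le_mul_of_nonneg_right (hs i) (by positivity)
    calc _ = |H (y + s i * (c * t)) - H y - c1 * (s i * (c * t)) - c2 * (s i * (c * t)) ^ 2| := by
          congr 1; ring
      _ ≤ M * |s i * (c * t)| ^ 3 := h1
      _ ≤ M * (S * c * |t|) ^ 3 := by gcongr
      _ = _ := by ring
  have hcm2 : Measurable fun t => H (y + s i * (c * t)) := hH.comp (by fun_prop)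
  have k1 := hμ.abs_integral_sub_quadratic_le
    (integrable_of_measurable_of_abs_le hcm2 fun t => hB _) hK
  have k2 := hν.abs_integral_sub_quadratic_le
    (integrable_of_measurable_of_abs_le hcm2 fun t => hB _) hK
  rw [abs_le] at k1 k2 ⊢
  constructor <;> linarith [k1.1, k1.2, k2.1, k2.2]

/-! ### Smoothing by the Gaussian bias -/

theorem integrable_exp_mul_abs_gaussianReal (c : ℝ≥0) (m : ℝ) :
    Integrable (fun b : ℝ => Real.exp (m * |b|)) (gaussianReal 0 c) := by
  refine ((integrable_exp_mul_gaussianReal (μ := 0) (v := c) m).add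
    (integrable_exp_mul_gaussianReal (μ := 0) (v := c) (-m))).mono'
    (by fun_prop) (.of_forall fun b => ?_)
  have h1 := Real.exp_nonneg (m * b)
  have h2 := Real.exp_nonneg (-m * b)
  simp only [Real.norm_eq_abs, abs_of_nonneg (Real.exp_nonneg _), Pi.add_apply]
  rcases abs_cases b with ⟨h, _⟩ | ⟨h, _⟩
  · rw [h]; linarith
  · rw [h, mul_neg, ← neg_mul]; linarith

/-- The Cameron–Martin formula: the shift moves from `h` to the density, so regularity in `t`
requires none of `h`. -/
theorem integral_add_gaussianReal {c : ℝ≥0} (hc : c ≠ 0) (h : ℝ → ℝ) (t : ℝ) :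
    ∫ b, h (t + b) ∂gaussianReal 0 c
      = ∫ b, h b * Real.exp (b * t / c - t ^ 2 / (2 * c)) ∂gaussianReal 0 c := by
  rw [integral_gaussianReal_eq_integral_smul hc, integral_gaussianReal_eq_integral_smul hc,
    ← integral_sub_right_eq_self _ t]
  congr 1
  ext b
  have hc' : (c : ℝ) ≠ 0 := by exact_mod_cast hc
  have : gaussianPDFReal 0 c (b - t)
      = gaussianPDFReal 0 c b * Real.exp (b * t / c - t ^ 2 / (2 * c)) := by
    rw [gaussianPDFReal, gaussianPDFReal, mul_assoc _ (Real.exp _), ← Real.exp_add]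
    congr 2
    field_simp
    ring
  rw [this, add_sub_cancel, smul_eq_mul, smul_eq_mul]
  ring

theorem hasJet_exp (I : Set ℝ) : HasJet I Real.exp Real.exp Real.exp Real.exp :=
  ⟨fun x _ => Real.hasDerivAt_exp x, fun x _ => Real.hasDerivAt_exp x,
    fun x _ => Real.hasDerivAt_exp x⟩

theorem hasJet_shift_exponent (I : Set ℝ) (b c : ℝ) :
    HasJet I (fun t => b * t / c - t ^ 2 / (2 * c)) (fun t => b / c - t / c) (fun _ => -(1 / c))
      (fun _ => 0) where
  d1 t _ := by
    refine ((((hasDerivAt_id t).const_mul b).div_const c).sub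
      (((hasDerivAt_id t).pow 2).div_const (2 * c))).congr_deriv ?_
    rcases eq_or_ne c 0 with rfl | hc
    · simp
    · simp; field_simp
  d2 t _ := (((hasDerivAt_const t (b / c)).sub ((hasDerivAt_id t).div_const c))).congr_deriv
    (by simp)
  d3 t _ := hasDerivAt_const _ _

theorem smoothBdd_gaussian_shift {c : ℝ≥0} (hc : 0 < c) :
    ∃ C : ℝ, 0 ≤ C ∧ ∀ (h : ℝ → ℝ) (A : ℝ), Measurable h → 0 ≤ A →
      (∀ b, |h b| ≤ A * (1 + |b|)) →
      SmoothBdd (Set.Ioo (-2) 2) (fun t => ∫ b, h (t + b) ∂gaussianReal 0 c) (A * C) := by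
  have hc' : (0 : ℝ) < c := by exact_mod_cast hc
  set K : ℝ := 1 + 3 / c with hK
  have hK1 : 1 ≤ K := by rw [hK]; linarith [show 0 ≤ 3 / (c : ℝ) by positivity]
  -- The term `2 / c` bounds the exponent `b * t / c` for `|t| ≤ 2`. The `4` absorbs four factors `1
  -- + |b| ≤ exp |b|`: one from the growth of `h` and three from the cube in `abs_jet_comp_le`.
  set m : ℝ := 2 / c + 4 with hm
  have hint := (integrable_exp_mul_abs_gaussianReal c m).const_mul (5 * K ^ 3)
  refine ⟨∫ b, 5 * K ^ 3 * Real.exp (m * |b|) ∂gaussianReal 0 c,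
    integral_nonneg fun b => by positivity, fun h A hh hA hb => ?_⟩
  rw [← integral_const_mul]
  simp only [integral_add_gaussianReal hc.ne']
  have hE : ∀ t ∈ Set.Ioo (-2 : ℝ) 2, ∀ b : ℝ,
      Real.exp (b * t / c - t ^ 2 / (2 * c)) ≤ Real.exp (2 / c * |b|) := fun t ht b => by
    refine Real.exp_le_exp.2 ?_
    have h1 : b * t ≤ |b| * 2 := by
      calc b * t ≤ |b * t| := le_abs_self _
        _ = |b| * |t| := abs_mul _ _
        _ ≤ |b| * 2 := mul_le_mul_of_nonneg_left (abs_lt.2 ht).le (abs_nonneg b)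
    have h2 : b * t / c ≤ |b| * 2 / c := by gcongr
    have h3 : 0 ≤ t ^ 2 / (2 * (c : ℝ)) := by positivity
    calc _ ≤ |b| * 2 / c := by linarith
      _ = _ := by ring
  have hab : ∀ b, 0 ≤ A * (1 + |b|) := fun b => by positivity
  have hD : ∀ b, |h b| * (5 * Real.exp (2 / c * |b|) * (K * (1 + |b|)) ^ 3)
      ≤ A * (5 * K ^ 3 * Real.exp (m * |b|)) := fun b => by
    have h1 : 1 + |b| ≤ Real.exp |b| := by linarith [Real.add_one_le_exp |b|]
    calc |h b| * (5 * Real.exp (2 / c * |b|) * (K * (1 + |b|)) ^ 3)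
        ≤ (A * Real.exp |b|) * (5 * Real.exp (2 / c * |b|) * (K * Real.exp |b|) ^ 3) := by
          gcongr
          exact (hb b).trans (by gcongr)
      _ = A * (5 * K ^ 3 * (Real.exp |b| ^ 4 * Real.exp (2 / c * |b|))) := by ring
      _ = _ := by
          rw [← Real.exp_nat_mul, ← Real.exp_add]
          congr 3
          rw [hm]; push_cast; ring
  have hcont : ∀ t : ℝ, Continuous fun b : ℝ => Real.exp (b * t / c - t ^ 2 / (2 * c)) := by
    intro t; fun_prop
  refine SmoothBdd.integral isOpen_Ioo (p := fun t b => h b * _)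
    (fun b => ((hasJet_exp Set.univ).comp (hasJet_shift_exponent _ b c)
      (Set.mapsTo_univ _ _)).const_mul (h b)) (fun t ht => ?_) (fun t ht => ⟨?_, ?_, ?_⟩)
    (hint.const_mul A) (fun t ht b => ?_)
  · refine (hint.const_mul A).mono' (by fun_prop) (.of_forall fun b => ?_)
    refine le_trans ?_ (hD b)
    rw [norm_mul, Real.norm_eq_abs, Real.norm_eq_abs, Real.abs_exp]
    gcongr
    have h1 : 1 ≤ (K * (1 + |b|)) ^ 3 :=
      one_le_pow₀ (one_le_mul_of_one_le_of_one_le hK1 (by linarith [abs_nonneg b]))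
    nlinarith [hE t ht b, Real.exp_pos (2 / c * |b|)]
  · fun_prop
  · fun_prop
  · fun_prop
  · have ha : 1 ≤ K * (1 + |b|) :=
      one_le_mul_of_one_le_of_one_le hK1 (by linarith [abs_nonneg b])
    have ht2 : |t| ≤ 2 := (abs_lt.2 ht).le
    have q1 : |b / c - t / c| ≤ K * (1 + |b|) := by
      rw [← sub_div, abs_div, abs_of_pos hc']
      calc |b - t| / c ≤ (|b| + 3) / c := by
            gcongr; linarith [abs_sub b t]
        _ ≤ (1 + (|b| + 3) / c) + (|b| + 2 * |b| / c) := by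
            have : 0 ≤ |b| + 2 * |b| / c := by positivity
            linarith
        _ = _ := by rw [hK]; field_simp; ring
    have q2 : |-(1 / (c : ℝ))| ≤ K * (1 + |b|) := by
      rw [abs_neg, abs_of_pos (by positivity)]
      have : 1 / (c : ℝ) ≤ K := by
        rw [hK]
        have : 1 / (c : ℝ) ≤ 3 / c := by gcongr; norm_num
        linarith
      nlinarith [abs_nonneg b]
    have q3 : |(0 : ℝ)| ≤ K * (1 + |b|) := by simp; linarith
    have hexp : |Real.exp (b * t / c - t ^ 2 / (2 * c))| ≤ Real.exp (2 / c * |b|) := by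
      rw [Real.abs_exp]; exact hE t ht b
    obtain ⟨k1, k2, k3⟩ := abs_jet_comp_le ha hexp hexp hexp q1 q2 q3
    refine ⟨?_, ?_, ?_⟩ <;> refine le_trans ?_ (hD b) <;> rw [abs_mul] <;> gcongr

/-- For `|t| ≤ 1` the shifted Gaussian density gives the expansion. For `|t| ≥ 1` each term is
separately at most a multiple of `A * |t| ^ 3`, by the oscillation bound, so no global bound on
derivatives is needed. -/
theorem taylorThree_gaussian_smoothing {c : ℝ≥0} (hc : 0 < c) :
    ∃ C : ℝ, 0 ≤ C ∧ ∀ (h : ℝ → ℝ) (A B : ℝ), Measurable h → 0 ≤ A → (∀ x, |h x| ≤ B) →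
      (∀ x y, |h x - h y| ≤ A * (1 + |x - y|)) →
      TaylorThree (fun x => ∫ b, h (x + b) ∂gaussianReal 0 c) (C * A) := by
  obtain ⟨C, hC, H⟩ := smoothBdd_gaussian_shift hc
  refine ⟨2 + 2 * C, by positivity, fun h A B hh hA hB hosc x => ?_⟩
  have hint : ∀ y, Integrable (fun b => h (y + b)) (gaussianReal 0 c) := fun y =>
    integrable_of_measurable_of_abs_le (hh.comp (measurable_const_add y)) fun b => hB _
  -- Subtracting the constant `h x` leaves a function of linear growth controlled by `A`; the bound
  -- `B` serves only for integrability.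
  obtain ⟨f1, f2, f3, hj, hb⟩ := H (fun b => h (x + b) - h x) A
    ((hh.comp (measurable_const_add x)).sub_const _) hA
    (fun b => by simpa using hosc (x + b) x)
  have heq : ∀ t, ∫ b, (h (x + (t + b)) - h x) ∂gaussianReal 0 c
      = ∫ b, h (x + t + b) ∂gaussianReal 0 c - h x := fun t => by
    simp only [← add_assoc]
    rw [integral_sub (hint _) (integrable_const _)]
    simp
  simp only [heq] at hj
  have h0 := hb 0 (by norm_num)
  refine ⟨f1 0, f2 0 / 2, fun t => ?_⟩
  have hAC : 0 ≤ A * C := by positivity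
  rcases le_total |t| 1 with ht | ht
  · have hsub : Set.uIcc (0 : ℝ) (0 + t) ⊆ Set.Ioo (-2) 2 := by
      intro u hu
      have := Set.abs_sub_left_of_mem_uIcc hu
      simp only [sub_zero, zero_add] at this
      exact abs_lt.1 (by linarith)
    have := hj.taylor hsub (fun u hu => (hb u hu).2.2)
    simp only [zero_add, add_zero] at this
    calc _ = _ := by congr 1; ring
      _ ≤ A * C * |t| ^ 3 := this
      _ ≤ (2 + 2 * C) * A * |t| ^ 3 := by
          refine mul_le_mul_of_nonneg_right ?_ (by positivity)
          nlinarith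
  · have t1 : |t| ≤ |t| ^ 3 := le_self_pow₀ ht (by norm_num)
    have t2 : |t| ^ 2 ≤ |t| ^ 3 := pow_le_pow_right₀ ht (by norm_num)
    have e1 : |∫ b, h (x + t + b) ∂gaussianReal 0 c - ∫ b, h (x + b) ∂gaussianReal 0 c|
        ≤ A * (1 + |t|) := by
      refine abs_integral_sub_integral_le (hint _) (hint _) fun b => ?_
      have := hosc (x + t + b) (x + b)
      rwa [show x + t + b - (x + b) = t by ring] at this
    have e2 : |f1 0 * t| ≤ A * C * |t| ^ 3 := by
      rw [abs_mul]; exact mul_le_mul h0.1 t1 (abs_nonneg t) hAC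
    have e3 : |f2 0 / 2 * t ^ 2| ≤ A * C * |t| ^ 3 := by
      rw [abs_mul, abs_pow]
      refine mul_le_mul ?_ t2 (by positivity) hAC
      rw [abs_div, abs_two]
      have := h0.2.1
      linarith [abs_nonneg (f2 0)]
    have e4 : A * (1 + |t|) ≤ A * (2 * |t| ^ 3) := by gcongr; linarith
    refine (abs_sub _ _).trans ?_
    refine (add_le_add_left (abs_sub _ _) _).trans ?_
    linarith

/-! ### Gaussian averages as functions of the variance -/

theorem pi_withDensity {ι α : Type*} [Fintype ι] [MeasurableSpace α]
    (m : ι → Measure α) [∀ i, IsProbabilityMeasure (m i)] {f : ι → α → ℝ≥0∞}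
    (hf : ∀ i, Measurable (f i)) [∀ i, SigmaFinite ((m i).withDensity (f i))] :
    Measure.pi (fun i => (m i).withDensity (f i))
      = (Measure.pi m).withDensity (fun y => ∏ i, f i (y i)) := by
  refine Measure.pi_eq fun s hs => ?_
  have hI : ∀ i, Measurable ((s i).indicator (f i)) := fun i => (hf i).indicator (hs i)
  have hind : iIndepFun (fun i (y : ι → α) => (s i).indicator (f i) (y i)) (Measure.pi m) :=
    iIndepFun_pi (X := fun i => (s i).indicator (f i)) fun i => (hI i).aemeasurable
  have hprod : ∀ y : ι → α, (Set.univ.pi s).indicator (fun y => ∏ i, f i (y i)) y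
      = ∏ i, (s i).indicator (f i) (y i) := by
    intro y
    classical
    by_cases hy : y ∈ Set.univ.pi s
    · rw [Set.indicator_of_mem hy]
      exact Finset.prod_congr rfl fun i _ => (Set.indicator_of_mem (hy i trivial) _).symm
    · rw [Set.indicator_of_notMem hy]
      simp only [Set.mem_univ_pi, not_forall] at hy
      obtain ⟨i, hi⟩ := hy
      exact (Finset.prod_eq_zero (Finset.mem_univ i) (Set.indicator_of_notMem hi _)).symm
  rw [withDensity_apply _ (.univ_pi hs), ← lintegral_indicator (.univ_pi hs)]
  simp only [hprod]
  rw [lintegral_prod_eq_prod_lintegral_of_indepFun Finset.univ _ hind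
    (fun i => (hI i).comp (measurable_pi_apply i))]
  refine Finset.prod_congr rfl fun i _ => ?_
  rw [withDensity_apply _ (hs i), ← lintegral_indicator (hs i)]
  exact (measurePreserving_eval m i).lintegral_comp (hI i)

/-- The mean of `Ψ` under the centred Gaussian measure with covariance `q • 1`. -/
noncomputable def gaussAvg {ι : Type*} [Fintype ι] (Ψ : (ι → ℝ) → ℝ) (q : ℝ) : ℝ :=
  ∫ y, Ψ (fun i => √q * y i) ∂Measure.pi (fun _ => gaussianReal 0 1)

theorem gaussAvg_eq_integral {ι : Type*} [Fintype ι] {Ψ : (ι → ℝ) → ℝ} (hΨ : Measurable Ψ)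
    (q : ℝ) : gaussAvg Ψ q = ∫ y, Ψ y ∂Measure.pi (fun _ => gaussianReal 0 q.toNNReal) := by
  have hmap : (gaussianReal 0 1).map (fun t => √q * t) = gaussianReal 0 q.toNNReal := by
    rw [gaussianReal_map_const_mul]
    congr 1
    · simp
    · rw [mul_one]
      ext
      simp only [NNReal.coe_mk, Real.coe_toNNReal']
      -- For `q ≤ 0` both `√q` and `q.toNNReal` vanish, so the identity holds for every real `q`.
      rcases le_total 0 q with h | h
      · rw [Real.sq_sqrt h, max_eq_left h]
      · rw [Real.sqrt_eq_zero_of_nonpos h, max_eq_right h]; simp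
  have hm : ∀ _ : ι, Measurable fun t : ℝ => √q * t := fun _ => measurable_const_mul _
  have : ∀ _ : ι, IsProbabilityMeasure ((gaussianReal 0 1).map fun t => √q * t) := fun _ => by
    rw [hmap]; infer_instance
  simp only [← hmap]
  rw [← Measure.pi_map_pi (μ := fun _ : ι => gaussianReal 0 1) fun i => (hm i).aemeasurable,
    integral_map (Measurable.aemeasurable (by fun_prop)) hΨ.aestronglyMeasurable, gaussAvg]

theorem measurable_gaussAvg {ι : Type*} [Fintype ι] {Ψ : (ι → ℝ) → ℝ} (hΨ : Measurable Ψ) :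
    Measurable (gaussAvg Ψ) :=
  (StronglyMeasurable.integral_prod_right
    (f := fun (q : ℝ) (y : ι → ℝ) => Ψ (fun i => √q * y i))
    (hΨ.comp (by fun_prop)).stronglyMeasurable).measurable

theorem abs_gaussAvg_le {ι : Type*} [Fintype ι] {Ψ : (ι → ℝ) → ℝ} {B : ℝ} (hB : ∀ y, |Ψ y| ≤ B)
    (q : ℝ) : |gaussAvg Ψ q| ≤ B :=
  abs_integral_le_of_abs_le fun _ => hB _

/-- The logarithm of the density of `N(0, q)` with respect to `N(0, v)` on a space of dimension
`d`, at a point with square norm `r`. -/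
noncomputable def logDensityRatio (d v r q : ℝ) : ℝ :=
  r * ((2 * v)⁻¹ - (2 * q)⁻¹) + d * ((Real.log v - Real.log q) / 2)

theorem gaussianReal_eq_withDensity {q v : ℝ≥0} (hq : 0 < q) (hv : 0 < v) :
    gaussianReal 0 q = (gaussianReal 0 v).withDensity
      (fun x => ENNReal.ofReal (Real.exp (logDensityRatio 1 v (x ^ 2) q))) := by
  rw [gaussianReal_of_var_ne_zero _ hq.ne', gaussianReal_of_var_ne_zero _ hv.ne',
    ← withDensity_mul _ (measurable_gaussianPDF _ _)
      (by unfold logDensityRatio; fun_prop)]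
  congr 1
  ext x
  rw [Pi.mul_apply, gaussianPDF, gaussianPDF, ← ENNReal.ofReal_mul (gaussianPDFReal_nonneg _ _ _)]
  congr 1
  have hq' : (0 : ℝ) < q := by exact_mod_cast hq
  have hv' : (0 : ℝ) < v := by exact_mod_cast hv
  have hsqrt : ∀ u : ℝ, 0 < u → (√(2 * Real.pi * u))⁻¹
      = (√(2 * Real.pi))⁻¹ * Real.exp (-(Real.log u / 2)) := fun u hu => by
    rw [Real.sqrt_mul (by positivity), mul_inv, Real.exp_neg, Real.sqrt_eq_rpow u,
      Real.rpow_def_of_pos hu]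
    congr 4
    ring
  rw [gaussianPDFReal, gaussianPDFReal, hsqrt _ hq', hsqrt _ hv', mul_assoc, mul_assoc, mul_assoc,
    ← Real.exp_add, ← Real.exp_add, ← Real.exp_add]
  congr 2
  unfold logDensityRatio
  field_simp
  ring

/-- With a fixed reference variance `v`, the dependence on `q` sits in an explicit density, and `Ψ`
need not be differentiable. -/
theorem gaussAvg_eq_integral_density {ι : Type*} [Fintype ι] {Ψ : (ι → ℝ) → ℝ}
    (hΨ : Measurable Ψ) {q v : ℝ} (hq : 0 < q) (hv : 0 < v) :
    gaussAvg Ψ q = ∫ y, Ψ y * Real.exp (logDensityRatio (Fintype.card ι) v (∑ i, y i ^ 2) q)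
      ∂Measure.pi (fun _ => gaussianReal 0 v.toNNReal) := by
  have hm : ∀ _ : ι, Measurable fun x : ℝ =>
      ENNReal.ofReal (Real.exp (logDensityRatio 1 v (x ^ 2) q)) := fun _ => by
    unfold logDensityRatio; fun_prop
  have hd := gaussianReal_eq_withDensity (Real.toNNReal_pos.2 hq) (Real.toNNReal_pos.2 hv)
  rw [Real.coe_toNNReal q hq.le, Real.coe_toNNReal v hv.le] at hd
  have : ∀ _ : ι, SigmaFinite ((gaussianReal 0 v.toNNReal).withDensity
      (fun x => ENNReal.ofReal (Real.exp (logDensityRatio 1 v (x ^ 2) q)))) := fun _ => by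
    rw [← hd]; infer_instance
  rw [gaussAvg_eq_integral hΨ]
  simp only [hd]
  rw [pi_withDensity (fun _ : ι => gaussianReal 0 v.toNNReal) hm]
  have hprod : ∀ y : ι → ℝ, ∏ i, ENNReal.ofReal (Real.exp (logDensityRatio 1 v (y i ^ 2) q))
      = ENNReal.ofReal (Real.exp (logDensityRatio (Fintype.card ι) v (∑ i, y i ^ 2) q)) := by
    intro y
    rw [← ENNReal.ofReal_prod_of_nonneg fun i _ => Real.exp_nonneg _, ← Real.exp_sum]
    congr 2
    simp only [logDensityRatio]
    rw [Finset.sum_add_distrib, ← Finset.sum_mul]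
    simp
  simp only [hprod]
  rw [integral_withDensity_eq_integral_toReal_smul
    (by unfold logDensityRatio; fun_prop) (.of_forall fun _ => ENNReal.ofReal_lt_top)]
  refine integral_congr_ae (.of_forall fun y => ?_)
  simp only [smul_eq_mul, ENNReal.toReal_ofReal (Real.exp_nonneg _)]
  ring

theorem hasJet_logDensityRatio (d v r : ℝ) :
    HasJet (Set.Ioi 0) (logDensityRatio d v r) (fun q => r / 2 / q ^ 2 - d / 2 / q)
      (fun q => -(r / q ^ 3) + d / 2 / q ^ 2) (fun q => 3 * r / q ^ 4 - d / q ^ 3) where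
  d1 q hq := by
    have hq : 0 < q := hq
    have h1 := (((hasDerivAt_id q).const_mul 2).fun_inv (by simp; exact hq.ne')).const_sub (2 * v)⁻¹
    have h2 := ((Real.hasDerivAt_log hq.ne').const_sub (Real.log v)).div_const 2
    refine ((h1.const_mul r).add (h2.const_mul d)).congr_deriv ?_
    simp only [id]
    field_simp
    ring
  d2 q hq := by
    have hq : 0 < q := hq
    have h1 := ((hasDerivAt_id q).fun_pow 2).fun_inv (by simp; exact hq.ne')
    have h2 := hasDerivAt_inv hq.ne'
    simp only [div_eq_mul_inv _ (_ : ℝ)]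
    refine ((h1.const_mul (r * 2⁻¹)).sub (h2.const_mul (d * 2⁻¹))).congr_deriv ?_
    simp only [id]
    field_simp
    ring
  d3 q hq := by
    have hq : 0 < q := hq
    have h1 := ((hasDerivAt_id q).fun_pow 3).fun_inv (by simp; exact hq.ne')
    have h2 := ((hasDerivAt_id q).fun_pow 2).fun_inv (by simp; exact hq.ne')
    simp only [div_eq_mul_inv _ (_ : ℝ)]
    refine ((h1.const_mul r).neg.add (h2.const_mul (d * 2⁻¹))).congr_deriv ?_
    simp only [id]
    field_simp
    ring

theorem abs_jet_logDensityRatio_le {lo d r q : ℝ} (hlo : 0 < lo) (hd0 : 0 ≤ d) (hr0 : 0 ≤ r)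
    (hq : lo ≤ q) :
    |r / 2 / q ^ 2 - d / 2 / q| ≤ 3 * (1 + d) * (1 + lo⁻¹) ^ 4 * (1 + r) ∧
      |-(r / q ^ 3) + d / 2 / q ^ 2| ≤ 3 * (1 + d) * (1 + lo⁻¹) ^ 4 * (1 + r) ∧
      |3 * r / q ^ 4 - d / q ^ 3| ≤ 3 * (1 + d) * (1 + lo⁻¹) ^ 4 * (1 + r) := by
  have hq0 : 0 < q := hlo.trans_le hq
  set l : ℝ := 1 + lo⁻¹ with hl
  have hl1 : 1 ≤ l := by rw [hl]; linarith [inv_pos.2 hlo]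
  have hql : q⁻¹ ≤ l := by
    have : q⁻¹ ≤ lo⁻¹ := by gcongr
    linarith
  have hqp : ∀ k : ℕ, k ≤ 4 → (q ^ k)⁻¹ ≤ l ^ 4 := fun k hk => by
    rw [← inv_pow]
    exact (pow_le_pow_left₀ (by positivity) hql k).trans (pow_le_pow_right₀ hl1 hk)
  have hdr : d + r ≤ (1 + d) * (1 + r) := by
    have := mul_nonneg hd0 hr0
    linarith
  have hgen : ∀ (a b : ℝ) (i j : ℕ), i ≤ 4 → j ≤ 4 → 0 ≤ a → 0 ≤ b → a ≤ 3 * r → b ≤ d →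
      a / q ^ i + b / q ^ j ≤ 3 * (1 + d) * l ^ 4 * (1 + r) := fun a b i j hi hj ha hb h1 h2 => by
    have e1 : a / q ^ i ≤ 3 * r * l ^ 4 := by
      rw [div_eq_mul_inv]; gcongr; exact hqp i hi
    have e2 : b / q ^ j ≤ d * l ^ 4 := by
      rw [div_eq_mul_inv]; gcongr; exact hqp j hj
    have : 0 < l ^ 4 := by positivity
    calc _ ≤ (3 * r + d) * l ^ 4 := by linarith
      _ ≤ (3 * ((1 + d) * (1 + r))) * l ^ 4 := by gcongr; linarith
      _ = _ := by ring
  have q1 : |r / 2 / q ^ 2 - d / 2 / q| ≤ 3 * (1 + d) * l ^ 4 * (1 + r) := by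
    refine (abs_sub _ _).trans ?_
    rw [abs_of_nonneg (by positivity), abs_of_nonneg (by positivity)]
    simpa using hgen (r / 2) (d / 2) 2 1 (by norm_num) (by norm_num) (by positivity)
      (by positivity) (by linarith) (by linarith)
  have q2 : |-(r / q ^ 3) + d / 2 / q ^ 2| ≤ 3 * (1 + d) * l ^ 4 * (1 + r) := by
    refine (abs_add_le _ _).trans ?_
    rw [abs_neg, abs_of_nonneg (by positivity), abs_of_nonneg (by positivity)]
    exact hgen r (d / 2) 3 2 (by norm_num) (by norm_num) (by positivity)
      (by positivity) (by linarith) (by linarith)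
  have q3 : |3 * r / q ^ 4 - d / q ^ 3| ≤ 3 * (1 + d) * l ^ 4 * (1 + r) := by
    refine (abs_sub _ _).trans ?_
    rw [abs_of_nonneg (by positivity), abs_of_nonneg (by positivity)]
    exact hgen (3 * r) d 4 3 (by norm_num) (by norm_num) (by positivity)
      (by positivity) (by linarith) (by linarith)
  exact ⟨q1, q2, q3⟩

theorem integrable_one_add_sum_abs_pow {ι : Type*} [Fintype ι] (v : ℝ≥0) (k : ℕ) :
    Integrable (fun y : ι → ℝ => (1 + ∑ i, |y i|) ^ k)
      (Measure.pi (fun _ => gaussianReal 0 v)) := by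
  rcases eq_or_ne k 0 with rfl | hk
  · simp
  have h1 : ∀ i : ι, MemLp (fun y : ι → ℝ => |y i|) k (Measure.pi (fun _ => gaussianReal 0 v)) :=
    fun i => ((memLp_id_gaussianReal' (μ := 0) (v := v) k (by simp)).comp_measurePreserving
      (measurePreserving_eval (fun _ : ι => gaussianReal 0 v) i)).abs
  have h2 := (memLp_const (μ := Measure.pi (fun _ : ι => gaussianReal 0 v)) (p := k) (1 : ℝ)).add
    (memLp_finsetSum Finset.univ fun i _ => h1 i)
  refine (h2.integrable_norm_pow hk).congr (.of_forall fun y => ?_)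
  simp only [Pi.add_apply, Real.norm_eq_abs]
  rw [abs_of_nonneg (by positivity)]

/-- The reference variance is the right end `hi`: for smaller `q` the coefficient of the square norm
in the exponent is nonpositive, so the density ratio is bounded uniformly in `y`. As before,
subtracting `F 0` leaves a bound in terms of `A` alone. -/
theorem smoothBdd_gaussAvg (ι : Type*) [Fintype ι] {lo hi : ℝ} (hlo : 0 < lo) (hlh : lo < hi) :
    ∃ C : ℝ, 0 ≤ C ∧ ∀ (F : (ι → ℝ) → ℝ) (A B : ℝ), Measurable F → 0 ≤ A → (∀ y, |F y| ≤ B) →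
      (∀ y y', |F y - F y'| ≤ A * (1 + ∑ i, |y i - y' i|)) →
      SmoothBdd (Set.Ioo lo hi) (gaussAvg F) (C * A) := by
  have hhi : 0 < hi := hlo.trans hlh
  set d : ℝ := (Fintype.card ι : ℝ) with hd
  have hd0 : 0 ≤ d := by positivity
  have hl1 : 1 ≤ 1 + lo⁻¹ := by linarith [inv_pos.2 hlo]
  set κ : ℝ := 3 * (1 + d) * (1 + lo⁻¹) ^ 4 with hκ
  have hκ1 : 1 ≤ κ := by
    rw [hκ]
    exact one_le_mul_of_one_le_of_one_le (by linarith) (one_le_pow₀ hl1)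
  set M : ℝ := Real.exp (d * ((Real.log hi - Real.log lo) / 2)) with hM
  have hM0 : 0 < M := Real.exp_pos _
  -- The power is `7 = 1 + 2 * 3`: one factor from the growth of `F - F 0`, and the cube of
  -- derivative bounds that are linear in the square norm.
  have hint := (integrable_one_add_sum_abs_pow (ι := ι) hi.toNNReal 7).const_mul (5 * M * κ ^ 3)
  refine ⟨∫ y, 5 * M * κ ^ 3 * (1 + ∑ i, |y i|) ^ 7
    ∂Measure.pi (fun _ : ι => gaussianReal 0 hi.toNNReal),
    integral_nonneg fun b => by positivity, fun F A B hF hA hB hosc => ?_⟩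
  rw [mul_comm, ← integral_const_mul]
  set G : (ι → ℝ) → ℝ := fun y => F y - F 0 with hG
  have hGm : Measurable G := hF.sub_const _
  have hGA : ∀ y, |G y| ≤ A * (1 + ∑ i, |y i|) := fun y => by simpa using hosc y 0
  have hFG : gaussAvg F = fun q => F 0 + gaussAvg G q := by
    ext q
    have : Integrable (fun y : ι → ℝ => F (fun i => √q * y i))
        (Measure.pi (fun _ : ι => gaussianReal 0 1)) :=
      integrable_of_measurable_of_abs_le (hF.comp (by fun_prop)) fun y => hB _
    simp only [gaussAvg, hG]
    rw [integral_sub this (integrable_const _)]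
    simp
  suffices h : SmoothBdd (Set.Ioo lo hi)
      (fun q => ∫ y, G y * Real.exp (logDensityRatio d hi (∑ i, y i ^ 2) q)
        ∂Measure.pi (fun _ : ι => gaussianReal 0 hi.toNNReal))
      (∫ y, A * (5 * M * κ ^ 3 * (1 + ∑ i, |y i|) ^ 7)
        ∂Measure.pi (fun _ : ι => gaussianReal 0 hi.toNNReal)) by
    obtain ⟨f1, f2, f3, hj, hb⟩ := h
    refine ⟨f1, f2, f3, ?_, hb⟩
    rw [hFG]
    refine HasJet.const_add _ ⟨fun q hq => (hj.d1 q hq).congr_of_eventuallyEq ?_, hj.d2, hj.d3⟩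
    filter_upwards [isOpen_Ioo.mem_nhds hq] with u hu
    exact gaussAvg_eq_integral_density hGm (hlo.trans hu.1) hhi
  have hE : ∀ q ∈ Set.Ioo lo hi, ∀ r : ℝ, 0 ≤ r →
      Real.exp (logDensityRatio d hi r q) ≤ M := fun q hq r hr => by
    refine Real.exp_le_exp.2 ?_
    have hq0 : 0 < q := hlo.trans hq.1
    have h1 : (2 * hi)⁻¹ ≤ (2 * q)⁻¹ := by
      gcongr; exact hq.2.le
    have h2 : Real.log lo ≤ Real.log q := Real.log_le_log hlo hq.1.le
    have h3 : r * ((2 * hi)⁻¹ - (2 * q)⁻¹) ≤ 0 :=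
      mul_nonpos_of_nonneg_of_nonpos hr (by linarith)
    have h4 : d * ((Real.log hi - Real.log q) / 2) ≤ d * ((Real.log hi - Real.log lo) / 2) := by
      gcongr
    unfold logDensityRatio
    linarith
  have hr : ∀ y : ι → ℝ, 1 + ∑ i, y i ^ 2 ≤ (1 + ∑ i, |y i|) ^ 2 := fun y => by
    have h0 : 0 ≤ ∑ i, |y i| := Finset.sum_nonneg fun i _ => abs_nonneg _
    have h1 : ∑ i, y i ^ 2 ≤ (∑ i, |y i|) ^ 2 := by
      simp only [← sq_abs (y _)]
      exact Finset.sum_sq_le_sq_sum_of_nonneg fun i _ => abs_nonneg _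
    nlinarith
  have hD : ∀ y, |G y| * (5 * M * (κ * (1 + ∑ i, y i ^ 2)) ^ 3)
      ≤ A * (5 * M * κ ^ 3 * (1 + ∑ i, |y i|) ^ 7) := fun y => by
    have h0 : 0 ≤ ∑ i, |y i| := Finset.sum_nonneg fun i _ => abs_nonneg _
    calc |G y| * (5 * M * (κ * (1 + ∑ i, y i ^ 2)) ^ 3)
        ≤ (A * (1 + ∑ i, |y i|)) * (5 * M * (κ * (1 + ∑ i, |y i|) ^ 2) ^ 3) := by
          gcongr
          · exact hGA y
          · exact hr y
      _ = _ := by ring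
  have h1r : ∀ y : ι → ℝ, 1 ≤ 1 + ∑ i, y i ^ 2 := fun y => by
    linarith [Finset.sum_nonneg fun (i : ι) (_ : i ∈ Finset.univ) => sq_nonneg (y i)]
  have hmeas : ∀ q, Measurable fun y : ι → ℝ => logDensityRatio d hi (∑ i, y i ^ 2) q := fun q => by
    unfold logDensityRatio; fun_prop
  refine SmoothBdd.integral isOpen_Ioo (p := fun q y => G y * _)
    (fun y => ((hasJet_exp Set.univ).comp
      ((hasJet_logDensityRatio d hi (∑ i, y i ^ 2)).mono fun q hq => hlo.trans hq.1)
      (Set.mapsTo_univ _ _)).const_mul (G y)) (fun q hq => ?_) (fun q hq => ⟨?_, ?_, ?_⟩)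
    (hint.const_mul A) (fun q hq y => ?_)
  · refine (hint.const_mul A).mono' (by fun_prop) (.of_forall fun y => ?_)
    refine le_trans ?_ (hD y)
    rw [norm_mul, Real.norm_eq_abs, Real.norm_eq_abs, Real.abs_exp]
    gcongr
    have h1 : 1 ≤ (κ * (1 + ∑ i, y i ^ 2)) ^ 3 :=
      one_le_pow₀ (one_le_mul_of_one_le_of_one_le hκ1 (h1r y))
    have h2 : M * 1 ≤ M * (κ * (1 + ∑ i, y i ^ 2)) ^ 3 := by gcongr
    linarith [hE q hq (∑ i, y i ^ 2) (by linarith [h1r y])]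
  · fun_prop
  · fun_prop
  · fun_prop
  · set r := ∑ i, y i ^ 2
    have hr1 := h1r y
    have hr0' : 0 ≤ r := by linarith
    have ha : 1 ≤ κ * (1 + r) := one_le_mul_of_one_le_of_one_le hκ1 hr1
    obtain ⟨q1, q2, q3⟩ := abs_jet_logDensityRatio_le hlo hd0 hr0' hq.1.le
    have hexp : |Real.exp (logDensityRatio d hi r q)| ≤ M := by
      rw [Real.abs_exp]; exact hE q hq r hr0'
    obtain ⟨k1, k2, k3⟩ := abs_jet_comp_le ha hexp hexp hexp q1 q2 q3
    refine ⟨?_, ?_, ?_⟩ <;> refine le_trans ?_ (hD y) <;> rw [abs_mul] <;> gcongr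

/-! ### The conditional variance of the next layer -/

/-- The variance of a neuron of the next layer, given that `s` is the square of the activation and
`y` is the present layer. -/
noncomputable def layerVar {ι : Type*} [Fintype ι] (cw cb : ℝ) (s : ℝ → ℝ) (y : ι → ℝ) : ℝ :=
  cb + cw / Fintype.card ι * ∑ i, s (y i)

theorem layerVar_mem_Icc {ι : Type*} [Fintype ι] {cw cb S : ℝ} {s : ℝ → ℝ} (hcw : 0 ≤ cw)
    (hs0 : ∀ x, 0 ≤ s x) (hs : ∀ x, s x ≤ S) (y : ι → ℝ) :
    layerVar cw cb s y ∈ Set.Icc cb (cb + cw * S) := by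
  have hS : 0 ≤ S := (hs0 0).trans (hs 0)
  have h0 : 0 ≤ ∑ i, s (y i) := Finset.sum_nonneg fun i _ => hs0 _
  have h1 : ∑ i, s (y i) ≤ Fintype.card ι * S := by
    simpa using Finset.sum_le_card_nsmul Finset.univ (fun i => s (y i)) S fun i _ => hs _
  refine ⟨le_add_of_nonneg_right (by positivity), ?_⟩
  refine add_le_add le_rfl ?_
  rcases eq_or_ne (Fintype.card ι : ℝ) 0 with h | h
  · rw [h]; simp; positivity
  · calc cw / Fintype.card ι * ∑ i, s (y i) ≤ cw / Fintype.card ι * (Fintype.card ι * S) := by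
          gcongr
      _ = cw * S := by field_simp

theorem measurable_layerVar {ι : Type*} [Fintype ι] {cw cb : ℝ} {s : ℝ → ℝ} (hs : Measurable s) :
    Measurable (layerVar (ι := ι) cw cb s) := by
  unfold layerVar; fun_prop

theorem smoothBdd_sqrt {lo : ℝ} (hlo : 0 < lo) :
    ∃ C, 1 ≤ C ∧ SmoothBdd (Set.Ioi lo) Real.sqrt C := by
  have hp : ∀ p : ℝ, p ≤ 0 → ∀ x ∈ Set.Ioi lo, |x ^ p| ≤ lo ^ p := fun p hp x hx => by
    rw [abs_of_nonneg (Real.rpow_nonneg (hlo.trans hx).le _)]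
    exact Real.rpow_le_rpow_of_nonpos hlo (le_of_lt hx) hp
  have hp0 : ∀ p : ℝ, 0 ≤ lo ^ p := fun p => Real.rpow_nonneg hlo.le _
  have h1 := hp0 (1 / 2 - 1)
  have h2 := hp0 (1 / 2 - 1 - 1)
  have h3 := hp0 (1 / 2 - 1 - 1 - 1)
  -- The summand `1` secures `1 ≤ C`, as `abs_jet_comp_le` requires.
  refine ⟨1 + lo ^ (1 / 2 - 1 : ℝ) + lo ^ (1 / 2 - 1 - 1 : ℝ) + lo ^ (1 / 2 - 1 - 1 - 1 : ℝ),
    by linarith, fun x => 1 / 2 * x ^ (1 / 2 - 1 : ℝ),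
    fun x => 1 / 2 * ((1 / 2 - 1) * x ^ (1 / 2 - 1 - 1 : ℝ)),
    fun x => 1 / 2 * ((1 / 2 - 1) * ((1 / 2 - 1 - 1) * x ^ (1 / 2 - 1 - 1 - 1 : ℝ))),
    ⟨fun x hx => ?_, fun x hx => ?_, fun x hx => ?_⟩, fun x hx => ⟨?_, ?_, ?_⟩⟩
  · have := Real.hasDerivAt_rpow_const (p := 1 / 2) (.inl (hlo.trans hx).ne')
    exact this.congr_of_eventuallyEq (.of_forall fun y => Real.sqrt_eq_rpow y)
  · exact (Real.hasDerivAt_rpow_const (.inl (hlo.trans hx).ne')).const_mul _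
  · exact ((Real.hasDerivAt_rpow_const (.inl (hlo.trans hx).ne')).const_mul _).const_mul _
  · have := hp (1 / 2 - 1) (by norm_num) x hx
    rw [abs_mul, abs_of_pos (by norm_num : (0 : ℝ) < 1 / 2)]
    linarith
  · have := hp (1 / 2 - 1 - 1) (by norm_num) x hx
    simp only
    rw [← mul_assoc, abs_mul, show |(1 / 2 * (1 / 2 - 1) : ℝ)| = 1 / 4 by norm_num [abs_of_neg]]
    linarith
  · have := hp (1 / 2 - 1 - 1 - 1) (by norm_num) x hx
    simp only
    rw [← mul_assoc, ← mul_assoc, abs_mul,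
      show |(1 / 2 * (1 / 2 - 1) * (1 / 2 - 1 - 1) : ℝ)| = 3 / 8 by norm_num]
    linarith

theorem integrable_one_add_abs_pow (v : ℝ≥0) (k : ℕ) :
    Integrable (fun t : ℝ => (1 + |t|) ^ k) (gaussianReal 0 v) := by
  rcases eq_or_ne k 0 with rfl | hk
  · simp
  have h2 := (memLp_const (μ := gaussianReal 0 v) (p := k) (1 : ℝ)).add
    (memLp_id_gaussianReal' (μ := 0) (v := v) k (by simp)).abs
  refine (h2.integrable_norm_pow hk).congr (.of_forall fun y => ?_)
  simp only [Pi.add_apply, Real.norm_eq_abs, id, Pi.abs_apply]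
  rw [abs_of_nonneg (by positivity)]

/-- The density argument would give constants growing with the dimension `n`. Here `Φ` is smooth
already, so the derivatives are taken through `√θ * y i` instead. Since `layerVar` is an average,
its derivatives are bounded by averages of one-dimensional functions, whose Gaussian means do not
depend on `n`. -/
theorem smoothBdd_gaussAvg_comp_layerVar {s : ℝ → ℝ} {S K cw cb hi : ℝ} (hcw : 0 ≤ cw)
    (hcb : 0 < cb) (hs0 : ∀ x, 0 ≤ s x) (hsS : ∀ x, s x ≤ S) (hhi : cb + cw * S < hi)
    (hs : SmoothBdd Set.univ s K) :
    ∃ C : ℝ, 0 ≤ C ∧ ∀ (n : ℕ), 0 < n → ∀ (Φ : ℝ → ℝ) (M B : ℝ), Measurable Φ →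
      (∀ q, |Φ q| ≤ B) → SmoothBdd (Set.Ioo (cb / 2) hi) Φ M →
      SmoothBdd (Set.Ioo (cb / 2) hi)
        (gaussAvg fun y : Fin n → ℝ => Φ (layerVar cw cb s y)) (C * M) := by
  obtain ⟨s1, s2, s3, hsj, hsb, hs1, hs2, hs3⟩ := hs.measurable_jet isOpen_univ
  have hsm : Measurable s :=
    (continuous_iff_continuousAt.2 fun x => (hsj.d1 x trivial).continuousAt).measurable
  have hK0 : 0 ≤ K := (abs_nonneg _).trans (hsb 0 trivial).1
  obtain ⟨κ, hκ, u1, u2, u3, huj, hub⟩ := smoothBdd_sqrt (half_pos hcb)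
  set L : ℝ := cw * (5 * K * κ ^ 3) with hL
  have hL0 : 0 ≤ L := by positivity
  have hint := (integrable_one_add_abs_pow 1 9).const_mul (5 * (1 + L) ^ 3)
  refine ⟨∫ t, 5 * (1 + L) ^ 3 * (1 + |t|) ^ 9 ∂gaussianReal 0 1,
    integral_nonneg fun b => by positivity, fun n hn Φ M B hΦ hB hΦs => ?_⟩
  have hn' : (0 : ℝ) < n := by exact_mod_cast hn
  obtain ⟨p1, p2, p3, hpj, hpb, hp1, hp2, hp3⟩ := hΦs.measurable_jet isOpen_Ioo
  have hmem : ∀ y : Fin n → ℝ, layerVar cw cb s y ∈ Set.Ioo (cb / 2) hi := fun y => by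
    have := layerVar_mem_Icc (cb := cb) hcw hs0 hsS y
    exact ⟨by linarith [this.1], this.2.trans_lt hhi⟩
  have hM0 : 0 ≤ M := (abs_nonneg _).trans (hpb _ (hmem 0)).1
  have hDint : ∀ i : Fin n, Integrable (fun y : Fin n → ℝ => 5 * (1 + L) ^ 3 * (1 + |y i|) ^ 9)
      (Measure.pi fun _ => gaussianReal 0 1) := fun i =>
    integrable_comp_eval (μ := fun _ : Fin n => gaussianReal 0 1)
      (f := fun t => 5 * (1 + L) ^ 3 * (1 + |t|) ^ 9) hint
  have hDeq : ∫ y : Fin n → ℝ, M * ((n : ℝ)⁻¹ * ∑ i, 5 * (1 + L) ^ 3 * (1 + |y i|) ^ 9)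
      ∂Measure.pi (fun _ => gaussianReal 0 1)
      = (∫ t, 5 * (1 + L) ^ 3 * (1 + |t|) ^ 9 ∂gaussianReal 0 1) * M := by
    rw [integral_const_mul, integral_const_mul, integral_finsetSum _ fun i _ => hDint i]
    have : ∀ i : Fin n, ∫ y : Fin n → ℝ, 5 * (1 + L) ^ 3 * (1 + |y i|) ^ 9
        ∂Measure.pi (fun _ => gaussianReal 0 1)
        = ∫ t, 5 * (1 + L) ^ 3 * (1 + |t|) ^ 9 ∂gaussianReal 0 1 := fun i =>
      integral_comp_eval (μ := fun _ : Fin n => gaussianReal 0 1) (i := i)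
        (f := fun t => 5 * (1 + L) ^ 3 * (1 + |t|) ^ 9) hint.aestronglyMeasurable
    simp only [this, Finset.sum_const, Finset.card_univ, Fintype.card_fin, nsmul_eq_mul]
    field_simp
  rw [← hDeq]
  have hjT : ∀ y : ℝ, HasJet (Set.Ioi (cb / 2)) (fun θ => s (√θ * y)) _ _ _ := fun y =>
    hsj.comp (huj.mul_const y) (Set.mapsTo_univ _ _)
  have hbT : ∀ y : ℝ, ∀ θ ∈ Set.Ioi (cb / 2), _ := fun y θ hθ =>
    have h1 : ∀ u : ℝ, |u| ≤ κ → |u * y| ≤ κ * (1 + |y|) := fun u hu => by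
      rw [abs_mul]
      exact mul_le_mul hu (by linarith) (abs_nonneg _) (by linarith)
    abs_jet_comp_le (one_le_mul_of_one_le_of_one_le hκ (by linarith [abs_nonneg y]))
      (hsb (√θ * y) trivial).1 (hsb (√θ * y) trivial).2.1 (hsb (√θ * y) trivial).2.2
      (h1 _ (hub θ hθ).1) (h1 _ (hub θ hθ).2.1) (h1 _ (hub θ hθ).2.2)
  have hjQ : ∀ y : Fin n → ℝ, HasJet (Set.Ioi (cb / 2))
      (fun θ => layerVar cw cb s fun i => √θ * y i) _ _ _ := fun y =>
    ((HasJet.sum Finset.univ fun i _ => hjT (y i)).const_mul _).const_add cb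
  have hbQ : ∀ (T : ℝ → ℝ) (y : Fin n → ℝ),
      (∀ t, |T t| ≤ 5 * K * (κ * (1 + |t|)) ^ 3) →
      |cw / (Fintype.card (Fin n) : ℝ) * ∑ i, T (y i)|
        ≤ (n : ℝ)⁻¹ * ∑ i, (1 + L) * (1 + |y i|) ^ 3 := fun T y hT => by
    rw [abs_mul, Fintype.card_fin, abs_of_nonneg (by positivity), div_eq_mul_inv, mul_comm cw,
      mul_assoc]
    gcongr
    refine (mul_le_mul_of_nonneg_left (Finset.abs_sum_le_sum_abs _ _) hcw).trans ?_
    rw [Finset.mul_sum]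
    refine Finset.sum_le_sum fun i _ => ?_
    calc cw * |T (y i)| ≤ cw * (5 * K * (κ * (1 + |y i|)) ^ 3) := by gcongr; exact hT _
      _ = L * (1 + |y i|) ^ 3 := by rw [hL]; ring
      _ ≤ _ := mul_le_mul_of_nonneg_right (by linarith) (by positivity)
  have hone : ∀ y : Fin n → ℝ, 1 ≤ (n : ℝ)⁻¹ * ∑ i, (1 + L) * (1 + |y i|) ^ 3 := fun y => by
    rw [inv_mul_eq_div, le_div_iff₀ hn', one_mul]
    have : ∀ i ∈ Finset.univ, (1 : ℝ) ≤ (1 + L) * (1 + |y i|) ^ 3 := fun i _ =>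
      one_le_mul_of_one_le_of_one_le (by linarith)
        (one_le_pow₀ (by linarith [abs_nonneg (y i)]))
    simpa using Finset.card_nsmul_le_sum Finset.univ _ 1 this
  -- By the power mean inequality the cube of the average is at most the average of the cubes. This
  -- keeps the dominating function an average over the neurons.
  have hcube : ∀ y : Fin n → ℝ, 5 * M * ((n : ℝ)⁻¹ * ∑ i, (1 + L) * (1 + |y i|) ^ 3) ^ 3
      ≤ M * ((n : ℝ)⁻¹ * ∑ i, 5 * (1 + L) ^ 3 * (1 + |y i|) ^ 9) := fun y => by
    have h := pow_sum_div_card_le_sum_pow (s := Finset.univ)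
      (f := fun i => (1 + L) * (1 + |y i|) ^ 3) (fun i _ => by positivity) 2
    rw [Finset.card_univ, Fintype.card_fin] at h
    calc 5 * M * ((n : ℝ)⁻¹ * ∑ i, (1 + L) * (1 + |y i|) ^ 3) ^ 3
        = 5 * M * (n : ℝ)⁻¹ * ((∑ i, (1 + L) * (1 + |y i|) ^ 3) ^ (2 + 1) / n ^ 2) := by
          field_simp
      _ ≤ 5 * M * (n : ℝ)⁻¹ * ∑ i, ((1 + L) * (1 + |y i|) ^ 3) ^ (2 + 1) := by gcongr
      _ = _ := by
          rw [Finset.mul_sum, Finset.mul_sum, Finset.mul_sum]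
          exact Finset.sum_congr rfl fun i _ => by ring
  refine SmoothBdd.integral isOpen_Ioo
    (p := fun θ (y : Fin n → ℝ) => Φ (layerVar cw cb s fun i => √θ * y i))
    (fun y => hpj.comp ((hjQ y).mono fun θ hθ => hθ.1) fun θ _ => hmem _)
    (fun θ hθ => integrable_of_measurable_of_abs_le
      (hΦ.comp ((measurable_layerVar hsm).comp (by fun_prop))) fun y => hB _)
    (fun θ hθ => ⟨?_, ?_, ?_⟩)
    (((integrable_finsetSum _ fun i _ => hDint i).const_mul _).const_mul _) (fun θ hθ y => ?_)
  · have := measurable_layerVar (ι := Fin n) (cw := cw) (cb := cb) hsm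
    fun_prop
  · have := measurable_layerVar (ι := Fin n) (cw := cw) (cb := cb) hsm
    fun_prop
  · have := measurable_layerVar (ι := Fin n) (cw := cw) (cb := cb) hsm
    fun_prop
  · have hq := hpb _ (hmem fun i => √θ * y i)
    obtain ⟨k1, k2, k3⟩ := abs_jet_comp_le (hone y) hq.1 hq.2.1 hq.2.2
      (hbQ _ y fun t => (hbT t θ hθ.1).1) (hbQ _ y fun t => (hbT t θ hθ.1).2.1)
      (hbQ _ y fun t => (hbT t θ hθ.1).2.2)
    exact ⟨k1.trans (hcube y), k2.trans (hcube y), k3.trans (hcube y)⟩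

/-- One coordinate enters `layerVar` with the factor `δ = cw / n`. Every term of the third
derivative of the composition contains at least one `δ`; the further ones are estimated by `δ ≤ cw`.
-/
theorem taylorThree_comp_layerVar {s : ℝ → ℝ} {S K cw cb hi : ℝ} (hcw : 0 ≤ cw)
    (hcb : 0 < cb) (hs0 : ∀ x, 0 ≤ s x) (hsS : ∀ x, s x ≤ S) (hhi : cb + cw * S < hi)
    (hs : SmoothBdd Set.univ s K) :
    ∃ C : ℝ, 0 ≤ C ∧ ∀ (n : ℕ), 0 < n → ∀ (Φ : ℝ → ℝ) (M : ℝ),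
      SmoothBdd (Set.Ioo (cb / 2) hi) Φ M → ∀ (a : Fin n → ℝ) (i : Fin n),
      TaylorThree (fun t => Φ (layerVar cw cb s (Function.update a i t))) (C * M / n) := by
  obtain ⟨s1, s2, s3, hsj, hsb⟩ := hs
  have hK0 : 0 ≤ K := (abs_nonneg _).trans (hsb 0 trivial).1
  refine ⟨cw * (cw ^ 2 * K ^ 3 + 3 * cw * K ^ 2 + K), by positivity, fun n hn Φ M hΦ a i => ?_⟩
  have hn' : (1 : ℝ) ≤ n := by exact_mod_cast hn
  obtain ⟨p1, p2, p3, hpj, hpb⟩ := hΦ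
  have hmem : ∀ y : Fin n → ℝ, layerVar cw cb s y ∈ Set.Ioo (cb / 2) hi := fun y => by
    have := layerVar_mem_Icc (cb := cb) hcw hs0 hsS y
    exact ⟨by linarith [this.1], this.2.trans_lt hhi⟩
  have hM0 : 0 ≤ M := (abs_nonneg _).trans (hpb _ (hmem 0)).1
  set δ : ℝ := cw / n with hδ
  have hδ0 : 0 ≤ δ := by positivity
  have hδc : δ ≤ cw := div_le_self hcw hn'
  set c0 : ℝ := cb + δ * ∑ j ∈ Finset.univ.erase i, s (a j) with hc0
  have heq : (fun t => layerVar cw cb s (Function.update a i t)) = fun t => c0 + δ * s t := by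
    ext t
    have : ∑ j ∈ Finset.univ.erase i, s (Function.update a i t j)
        = ∑ j ∈ Finset.univ.erase i, s (a j) :=
      Finset.sum_congr rfl fun j hj => by simp [Finset.ne_of_mem_erase hj]
    rw [layerVar, ← Finset.add_sum_erase _ _ (Finset.mem_univ i), Function.update_self, this, hc0,
      hδ, Fintype.card_fin]
    ring
  have hj : HasJet Set.univ (fun t => layerVar cw cb s (Function.update a i t))
      (fun t => δ * s1 t) (fun t => δ * s2 t) (fun t => δ * s3 t) := by
    rw [heq]
    exact (hsj.const_mul δ).const_add c0
  refine (hpj.comp hj fun t _ => hmem _).taylorThree fun t => ?_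
  have hp := hpb _ (hmem (Function.update a i t))
  have hb := hsb t trivial
  set P1 := p1 (layerVar cw cb s (Function.update a i t))
  set P2 := p2 (layerVar cw cb s (Function.update a i t))
  set P3 := p3 (layerVar cw cb s (Function.update a i t))
  have hd : ∀ {z : ℝ}, |z| ≤ K → |δ * z| ≤ δ * K := fun hz => by
    rw [abs_mul, abs_of_nonneg hδ0]; gcongr
  have e1 : |P3 * (δ * s1 t) ^ 3| ≤ M * (δ * K) ^ 3 := by
    rw [abs_mul, abs_pow]
    have := hd hb.1
    gcongr
    exact hp.2.2
  have e2 : |3 * P2 * (δ * s1 t) * (δ * s2 t)| ≤ 3 * M * (δ * K) * (δ * K) := by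
    rw [abs_mul, abs_mul, abs_mul, abs_of_pos (by norm_num : (0 : ℝ) < 3)]
    have h1 := hd hb.1
    have h2 := hd hb.2.1
    gcongr
    exact hp.2.1
  have e3 : |P1 * (δ * s3 t)| ≤ M * (δ * K) := by
    rw [abs_mul]
    have := hd hb.2.2
    gcongr
    exact hp.1
  refine (abs_add_le _ _).trans ((add_le_add_left (abs_add_le _ _) _).trans ?_)
  calc _ ≤ M * (δ * K) ^ 3 + 3 * M * (δ * K) * (δ * K) + M * (δ * K) := by linarith
    _ = M * δ * (δ ^ 2 * K ^ 3 + 3 * δ * K ^ 2 + K) := by ring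
    _ ≤ M * δ * (cw ^ 2 * K ^ 3 + 3 * cw * K ^ 2 + K) := by gcongr
    _ = _ := by rw [hδ]; ring

/-! ### The law of one neuron given the preceding layer -/

theorem map_sum_pi_gaussianReal {ι : Type*} [Fintype ι] (v : ι → ℝ≥0) (a : ι → ℝ) :
    (Measure.pi fun i => gaussianReal 0 (v i)).map (fun r => ∑ i, a i * r i)
      = gaussianReal 0 (∑ i, ‖a i‖₊ ^ 2 * v i) := by
  have hm : Measurable fun r : ι → ℝ => ∑ i, a i * r i := by fun_prop
  have := Measure.isProbabilityMeasure_map (μ := Measure.pi fun i => gaussianReal 0 (v i))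
    hm.aemeasurable
  refine Measure.ext_of_charFun ?_
  ext t
  rw [charFun_apply_real, integral_map hm.aemeasurable (by fun_prop), charFun_gaussianReal]
  have h1 : ∀ r : ι → ℝ, Complex.exp (t * ((∑ i, a i * r i : ℝ) : ℂ) * Complex.I)
      = ∏ i, Complex.exp ((t * a i : ℝ) * (r i : ℂ) * Complex.I) := fun r => by
    rw [← Complex.exp_sum]
    congr 1
    push_cast
    rw [Finset.mul_sum, Finset.sum_mul]
    exact Finset.sum_congr rfl fun i _ => by ring
  simp only [h1]
  rw [integral_fintype_prod_eq_prod
    (f := fun i (x : ℝ) => Complex.exp ((t * a i : ℝ) * (x : ℂ) * Complex.I))]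
  have h2 : ∀ i, ∫ x : ℝ, Complex.exp ((t * a i : ℝ) * (x : ℂ) * Complex.I) ∂gaussianReal 0 (v i)
      = Complex.exp (-(v i * (t * a i) ^ 2 / 2)) := fun i => by
    rw [← charFun_apply_real, charFun_gaussianReal]
    congr 1
    push_cast
    ring
  simp only [h2]
  rw [← Complex.exp_sum]
  congr 1
  push_cast
  simp only [← Complex.ofReal_pow, Real.norm_eq_abs, sq_abs]
  rw [Finset.sum_mul, Finset.sum_neg_distrib, Finset.sum_div]
  simp only [mul_zero, zero_mul, zero_sub]
  congr 1
  refine Finset.sum_congr rfl fun i _ => ?_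
  push_cast
  ring

/-- The law of `∑ j, s j * a j + b` for independent `a j` with law `lam` and `b ∼ N(0, c)`. -/
noncomputable def rowLaw {ι : Type*} [Fintype ι] (lam : Measure ℝ) (c : ℝ≥0) (s : ι → ℝ) :
    Measure ℝ :=
  ((Measure.pi fun _ : ι => lam).prod (gaussianReal 0 c)).map
    (fun p => ∑ j, s j * p.1 j + p.2)

theorem measurable_row {ι : Type*} [Fintype ι] (s : ι → ℝ) :
    Measurable (fun p : (ι → ℝ) × ℝ => ∑ j, s j * p.1 j + p.2) := by fun_prop

instance isProbabilityMeasure_rowLaw {ι : Type*} [Fintype ι] (lam : Measure ℝ)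
    [IsProbabilityMeasure lam] (c : ℝ≥0) (s : ι → ℝ) : IsProbabilityMeasure (rowLaw lam c s) :=
  Measure.isProbabilityMeasure_map (measurable_row s).aemeasurable

/-- The laws of the weights (`some j`) and of the bias (`none`) of a single neuron. -/
noncomputable def neuronLaw {ι : Type*} (lam : Measure ℝ) (c : ℝ≥0) (o : Option ι) : Measure ℝ :=
  o.elim (gaussianReal 0 c) fun _ => lam

instance isProbabilityMeasure_neuronLaw {ι : Type*} (lam : Measure ℝ) [IsProbabilityMeasure lam]
    (c : ℝ≥0) (o : Option ι) : IsProbabilityMeasure (neuronLaw lam c o) := by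
  cases o
  · exact inferInstanceAs (IsProbabilityMeasure (gaussianReal 0 c))
  · assumption

theorem rowLaw_eq_map_pi {ι : Type*} [Fintype ι] (lam : Measure ℝ) [IsProbabilityMeasure lam]
    (c : ℝ≥0) (s : ι → ℝ) :
    rowLaw lam c s = (Measure.pi (neuronLaw (ι := ι) lam c)).map
      (fun r => ∑ j, s j * r (some j) + r none) := by
  rw [← Measure.pi_map_piOptionEquivProd (neuronLaw (ι := ι) lam c),
    Measure.map_map (by fun_prop) (MeasurableEquiv.measurable _)]
  rfl

theorem rowLaw_gaussianReal {ι : Type*} [Fintype ι] (v c : ℝ≥0) (s : ι → ℝ) :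
    rowLaw (gaussianReal 0 v) c s = gaussianReal 0 (∑ j, ‖s j‖₊ ^ 2 * v + c) := by
  have h : neuronLaw (ι := ι) (gaussianReal 0 v) c
      = fun o => gaussianReal 0 (o.elim c fun _ => v) := by
    ext1 o
    cases o <;> rfl
  have := map_sum_pi_gaussianReal (fun o : Option ι => o.elim c fun _ => v)
    (fun o => o.elim 1 s)
  simp only [Fintype.sum_option, Option.elim_none, Option.elim_some, one_mul, nnnorm_one,
    one_pow] at this
  rw [rowLaw_eq_map_pi, h, add_comm _ c, ← this]
  simp only [add_comm]

theorem integral_pi_rowLaw {ι κ : Type*} [Fintype ι] [Fintype κ] (lam : Measure ℝ)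
    [IsProbabilityMeasure lam] (c : ℝ≥0) {Ψ : (κ → ℝ) → ℝ} (hΨ : Measurable Ψ) (s : ι → ℝ) :
    ∫ y, Ψ y ∂Measure.pi (fun _ => rowLaw lam c s)
      = ∫ t, Ψ (fun i => ∑ j, s j * t i (some j) + t i none)
        ∂Measure.pi (fun _ : κ => Measure.pi (neuronLaw (ι := ι) lam c)) := by
  have hr : ∀ _ : κ, Measurable fun r : Option ι → ℝ =>
    ∑ j, s j * r (some j) + r none := fun _ => by fun_prop
  have hsf : ∀ _ : κ, SigmaFinite ((Measure.pi (neuronLaw (ι := ι) lam c)).map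
      (fun r => ∑ j, s j * r (some j) + r none)) := fun _ => by
    rw [← rowLaw_eq_map_pi lam c s]; infer_instance
  simp only [rowLaw_eq_map_pi]
  rw [← Measure.pi_map_pi (μ := fun _ : κ => Measure.pi (neuronLaw (ι := ι) lam c))
    (fun i => (hr i).aemeasurable),
    integral_map (Measurable.aemeasurable (by fun_prop)) hΨ.aestronglyMeasurable]

theorem measurable_integral_pi_rowLaw {ι κ : Type*} [Fintype ι] [Fintype κ] (lam : Measure ℝ)
    [IsProbabilityMeasure lam] (c : ℝ≥0) {Ψ : (κ → ℝ) → ℝ} (hΨ : Measurable Ψ) :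
    Measurable fun s : ι → ℝ => ∫ y, Ψ y ∂Measure.pi (fun _ => rowLaw lam c s) := by
  simp only [integral_pi_rowLaw lam c hΨ]
  exact (StronglyMeasurable.integral_prod_right
    (f := fun (s : ι → ℝ) (t : κ → Option ι → ℝ) => Ψ (fun i => ∑ j, s j * t i (some j) + t i none))
    (hΨ.comp (by fun_prop)).stronglyMeasurable).measurable

/-- Both orders of integration are used. With the bias inside, it smooths a rough `h`; with the
weights inside, the bias is a mere shift of a test function that is smooth already. -/
theorem integral_rowLaw {ι : Type*} [Fintype ι] (lam : Measure ℝ) [IsProbabilityMeasure lam]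
    (c : ℝ≥0) (s : ι → ℝ) {h : ℝ → ℝ} (hh : Measurable h) {B : ℝ} (hB : ∀ x, |h x| ≤ B) :
    ∫ y, h y ∂rowLaw lam c s
        = ∫ a, ∫ b, h (∑ j, s j * a j + b) ∂gaussianReal 0 c ∂Measure.pi (fun _ : ι => lam) ∧
      ∫ y, h y ∂rowLaw lam c s
        = ∫ b, ∫ a, h (∑ j, s j * a j + b) ∂Measure.pi (fun _ : ι => lam) ∂gaussianReal 0 c := by
  have hint : Integrable (fun p : (ι → ℝ) × ℝ => h (∑ j, s j * p.1 j + p.2))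
      ((Measure.pi fun _ : ι => lam).prod (gaussianReal 0 c)) :=
    integrable_of_measurable_of_abs_le (hh.comp (measurable_row s)) fun _ => hB _
  rw [rowLaw, integral_map (measurable_row s).aemeasurable hh.aestronglyMeasurable]
  exact ⟨integral_prod _ hint, integral_prod_symm _ hint⟩

/-- For fixed weights the neuron is a translate of the nondegenerate Gaussian bias. -/
theorem rowLaw_absolutelyContinuous {ι : Type*} [Fintype ι] (lam : Measure ℝ)
    [IsProbabilityMeasure lam] {c : ℝ≥0} (hc : c ≠ 0) (s : ι → ℝ) : rowLaw lam c s ≪ volume := by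
  refine Measure.AbsolutelyContinuous.mk fun N hN h0 => ?_
  rw [rowLaw, Measure.map_apply (measurable_row s) hN,
    Measure.prod_apply ((measurable_row s) hN)]
  refine (lintegral_congr fun a => ?_).trans lintegral_zero
  have : Prod.mk a ⁻¹' ((fun p : (ι → ℝ) × ℝ => ∑ j, s j * p.1 j + p.2) ⁻¹' N)
      = (fun b => ∑ j, s j * a j + b) ⁻¹' N := rfl
  rw [this]
  refine gaussianReal_absolutelyContinuous 0 hc ?_
  rw [measure_preimage_add, h0]

/-! ### Conditioning on a layer -/

/-- Independent weights `v` with laws `lam ℓ` and Gaussian biases `b`. -/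
structure IsIndepNetwork {Ω : Type*} [MeasurableSpace Ω] (P : Measure Ω) (L : ℕ) (n : ℕ → ℕ)
    (lam : ℕ → Measure ℝ) (cb : ℝ≥0) (v : (ℓ : ℕ) → Fin (n (ℓ + 1)) → Fin (n ℓ) → Ω → ℝ)
    (b : (ℓ : ℕ) → Fin (n (ℓ + 1)) → Ω → ℝ) : Prop where
  measurable_weight : ∀ ℓ i j, Measurable (v ℓ i j)
  measurable_bias : ∀ ℓ i, Measurable (b ℓ i)
  law_weight : ∀ ℓ ≤ L, ∀ i j, P.map (v ℓ i j) = lam ℓ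
  law_bias : ∀ ℓ ≤ L, ∀ i, P.map (b ℓ i) = gaussianReal 0 cb
  indep : iIndepFun (Sum.elim (fun p : WeightIndex L n => v p.1 p.2.1 p.2.2)
    (fun p : BiasIndex L n => b p.1 p.2)) P

/-- The layers of a random network. -/
def randomLayer {Ω : Type*} (n : ℕ → ℕ) (σ : ℝ → ℝ)
    (v : (ℓ : ℕ) → Fin (n (ℓ + 1)) → Fin (n ℓ) → Ω → ℝ)
    (b : (ℓ : ℕ) → Fin (n (ℓ + 1)) → Ω → ℝ) (x : Fin (n 0) → ℝ) (ℓ : ℕ) (ω : Ω) :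
    Fin (n (ℓ + 1)) → ℝ :=
  networkLayer n σ (fun ℓ => Matrix.of fun i j => v ℓ i j ω) (fun ℓ i => b ℓ i ω) x ℓ

section

variable {Ω : Type*} {n : ℕ → ℕ} {σ : ℝ → ℝ}
  {v : (ℓ : ℕ) → Fin (n (ℓ + 1)) → Fin (n ℓ) → Ω → ℝ}
  {b : (ℓ : ℕ) → Fin (n (ℓ + 1)) → Ω → ℝ} {x : Fin (n 0) → ℝ}

theorem randomLayer_zero (ω : Ω) (i : Fin (n 1)) :
    randomLayer n σ v b x 0 ω i = ∑ j, v 0 i j ω * x j + b 0 i ω := rfl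

theorem randomLayer_succ (ℓ : ℕ) (ω : Ω) (i : Fin (n (ℓ + 2))) :
    randomLayer n σ v b x (ℓ + 1) ω i
      = ∑ j, σ (randomLayer n σ v b x ℓ ω j) * v (ℓ + 1) i j ω + b (ℓ + 1) i ω := by
  simp only [mul_comm (σ _)]
  rfl

theorem measurable_randomLayer [MeasurableSpace Ω] (hσ : Measurable σ) (ℓ : ℕ)
    (hv : ∀ ℓ' ≤ ℓ, ∀ i j, Measurable (v ℓ' i j)) (hb : ∀ ℓ' ≤ ℓ, ∀ i, Measurable (b ℓ' i)) :
    Measurable (randomLayer n σ v b x ℓ) := by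
  refine measurable_pi_lambda _ fun i => ?_
  induction ℓ with
  | zero =>
    simp only [randomLayer_zero]
    exact (Finset.measurable_fun_sum _ fun j _ => (hv 0 le_rfl i j).mul_const _).add (hb 0 le_rfl i)
  | succ ℓ ih =>
    simp only [randomLayer_succ]
    exact (Finset.measurable_fun_sum _ fun j _ =>
      (hσ.comp (ih (fun ℓ' h => hv ℓ' (by omega)) (fun ℓ' h => hb ℓ' (by omega)) j)).mul
        (hv _ le_rfl i j)).add (hb _ le_rfl i)

/-- All the weights and biases that enter layer `ℓ`, neuron by neuron. -/
def neuronData (v : (ℓ : ℕ) → Fin (n (ℓ + 1)) → Fin (n ℓ) → Ω → ℝ)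
    (b : (ℓ : ℕ) → Fin (n (ℓ + 1)) → Ω → ℝ) (ℓ : ℕ) (ω : Ω) (i : Fin (n (ℓ + 1)))
    (o : Option (Fin (n ℓ))) : ℝ :=
  o.elim (b ℓ i ω) fun j => v ℓ i j ω

variable [MeasurableSpace Ω] {P : Measure Ω} {L : ℕ}
  {lam : ℕ → Measure ℝ} {cb : ℝ≥0}

theorem IsIndepNetwork.measurable_neuronData (h : IsIndepNetwork P L n lam cb v b) (ℓ : ℕ) :
    Measurable (neuronData v b ℓ) := by
  refine measurable_pi_lambda _ fun i => measurable_pi_lambda _ fun o => ?_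
  cases o
  · exact h.measurable_bias ℓ i
  · exact h.measurable_weight ℓ i _

theorem IsIndepNetwork.measurable_layer (h : IsIndepNetwork P L n lam cb v b) (hσ : Measurable σ)
    (ℓ : ℕ) : Measurable (randomLayer n σ v b x ℓ) :=
  measurable_randomLayer hσ ℓ (fun ℓ' _ => h.measurable_weight ℓ')
    (fun ℓ' _ => h.measurable_bias ℓ')

/-- The layer `ℓ` is measurable with respect to the variables of index at most `ℓ`, the new data
with respect to those of index `ℓ + 1`, and these index sets are disjoint. -/
theorem IsIndepNetwork.indepFun_layer (h : IsIndepNetwork P L n lam cb v b) (hσ : Measurable σ)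
    {ℓ : ℕ} (hℓ : ℓ + 1 ≤ L) :
    IndepFun (randomLayer n σ v b x ℓ) (neuronData v b (ℓ + 1)) P := by
  set X := Sum.elim (fun p : WeightIndex L n => v p.1 p.2.1 p.2.2)
    (fun p : BiasIndex L n => b p.1 p.2) with hX
  set lay : WeightIndex L n ⊕ BiasIndex L n → ℕ := Sum.elim (fun p => p.1) (fun p => p.1) with hlay
  have hmeas : ∀ p, MeasurableSpace.comap (X p) inferInstance ≤
      (inferInstance : MeasurableSpace Ω) := by
    rintro (p | p)
    · exact (h.measurable_weight _ _ _).comap_le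
    · exact (h.measurable_bias _ _).comap_le
  have hind := indep_iSup_of_disjoint hmeas h.indep
    (S := {p | lay p ≤ ℓ}) (T := {p | lay p = ℓ + 1}) (Set.disjoint_left.2 fun p hp hq => by
      simp only [Set.mem_ofPred_eq] at hp hq; omega)
  have hle : ∀ (S : Set (WeightIndex L n ⊕ BiasIndex L n)), ∀ p ∈ S,
      Measurable[⨆ p ∈ S, MeasurableSpace.comap (X p) inferInstance] (X p) := fun S p hp =>
    Measurable.mono (comap_measurable (X p))
      (le_iSup₂_of_le (f := fun p _ => MeasurableSpace.comap (X p) inferInstance) p hp le_rfl) le_rfl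
  rw [IndepFun_iff_Indep]
  refine indep_of_indep_of_le_right (indep_of_indep_of_le_left hind ?_) ?_
  · refine Measurable.comap_le (@measurable_randomLayer Ω n σ v b x
      (⨆ p ∈ {p | lay p ≤ ℓ}, MeasurableSpace.comap (X p) inferInstance) hσ ℓ
      (fun ℓ' h' i j => ?_) (fun ℓ' h' i => ?_))
    · exact hle {p | lay p ≤ ℓ} (.inl ⟨⟨ℓ', by omega⟩, (i, j)⟩) h'
    · exact hle {p | lay p ≤ ℓ} (.inr ⟨⟨ℓ', by omega⟩, i⟩) h'
  · refine Measurable.comap_le (@measurable_pi_lambda _ _ _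
      (⨆ p ∈ {p | lay p = ℓ + 1}, MeasurableSpace.comap (X p) inferInstance) _ _ fun i =>
      @measurable_pi_lambda _ _ _
      (⨆ p ∈ {p | lay p = ℓ + 1}, MeasurableSpace.comap (X p) inferInstance) _ _ fun o => ?_)
    cases o with
    | none => exact hle {p | lay p = ℓ + 1} (.inr ⟨⟨ℓ + 1, by omega⟩, i⟩) rfl
    | some j => exact hle {p | lay p = ℓ + 1} (.inl ⟨⟨ℓ + 1, by omega⟩, (i, j)⟩) rfl

theorem IsIndepNetwork.map_neuronData (h : IsIndepNetwork P L n lam cb v b)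
    [hlam : ∀ ℓ, IsProbabilityMeasure (lam ℓ)] {ℓ : ℕ} (hℓ : ℓ ≤ L) :
    P.map (neuronData v b ℓ)
      = Measure.pi fun _ : Fin (n (ℓ + 1)) =>
          Measure.pi (neuronLaw (ι := Fin (n ℓ)) (lam ℓ) cb) := by
  -- The variables of index `ℓ` are selected from the independent family and grouped by neuron;
  -- currying the product measure then gives a product over neurons of products over their inputs.
  set e : (Σ _ : Fin (n (ℓ + 1)), Option (Fin (n ℓ))) → WeightIndex L n ⊕ BiasIndex L n :=
    fun p => p.2.elim (.inr ⟨⟨ℓ, by omega⟩, p.1⟩) fun j => .inl ⟨⟨ℓ, by omega⟩, (p.1, j)⟩ with he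
  have hinj : Function.Injective e := by
    rintro ⟨i, _ | j⟩ ⟨i', _ | j'⟩ hij
    · simpa [he] using hij
    · simp [he] at hij
    · simp [he] at hij
    · simpa [he] using hij
  have hind := h.indep.precomp hinj
  set Y : (Σ _ : Fin (n (ℓ + 1)), Option (Fin (n ℓ))) → Ω → ℝ :=
    fun p ω => neuronData v b ℓ ω p.1 p.2 with hY
  have hYm : ∀ p, Measurable (Y p) := fun p =>
    (measurable_pi_apply p.2).comp ((measurable_pi_apply p.1).comp (h.measurable_neuronData ℓ))
  have hYi : iIndepFun Y P := by
    convert hind using 1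
    ext1 ⟨i, o⟩
    cases o <;> rfl
  have hlaw : ∀ p, P.map (Y p) = neuronLaw (lam ℓ) cb p.2 := by
    rintro ⟨i, _ | j⟩
    · exact h.law_bias ℓ hℓ i
    · exact h.law_weight ℓ hℓ i j
  have h1 := hYi.map_fun_eq_infinitePi_map hYm
  simp only [hlaw] at h1
  have h2 := Measure.infinitePi_map_piCurry
    (X := fun (_ : Fin (n (ℓ + 1))) (_ : Option (Fin (n ℓ))) => ℝ)
    (fun (_ : Fin (n (ℓ + 1))) (o : Option (Fin (n ℓ))) => neuronLaw (lam ℓ) cb o)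
  rw [← h1, Measure.map_map (MeasurableEquiv.measurable _)
    (measurable_pi_lambda _ hYm)] at h2
  simp only [Measure.infinitePi_eq_pi] at h2
  exact h2

variable [IsProbabilityMeasure P]

/-- The Markov property of the layers: by independence, Fubini freezes the layer `ℓ` while the fresh
weights and biases are integrated out. -/
theorem IsIndepNetwork.integral_layer_succ (h : IsIndepNetwork P L n lam cb v b)
    [hlam : ∀ ℓ, IsProbabilityMeasure (lam ℓ)] (hσ : Measurable σ) {ℓ : ℕ} (hℓ : ℓ + 1 ≤ L)
    {Ψ : (Fin (n (ℓ + 2)) → ℝ) → ℝ} (hΨ : Measurable Ψ) {B : ℝ} (hB : ∀ y, |Ψ y| ≤ B) :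
    ∫ ω, Ψ (randomLayer n σ v b x (ℓ + 1) ω) ∂P
      = ∫ ω, ∫ y, Ψ y ∂Measure.pi (fun _ => rowLaw (lam (ℓ + 1)) cb
          fun j => σ (randomLayer n σ v b x ℓ ω j)) ∂P := by
  have hz := h.measurable_layer (x := x) hσ ℓ
  have hT := h.measurable_neuronData (ℓ + 1)
  have hlaw := h.map_neuronData hℓ
  have hprod := (h.indepFun_layer (x := x) hσ hℓ).map_prod_eq_prod_map_map
    hz.aemeasurable hT.aemeasurable
  have := Measure.isProbabilityMeasure_map (μ := P) hz.aemeasurable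
  have := Measure.isProbabilityMeasure_map (μ := P) hT.aemeasurable
  set G : (Fin (n (ℓ + 1)) → ℝ) × (Fin (n (ℓ + 2)) → Option (Fin (n (ℓ + 1))) → ℝ) →
      Fin (n (ℓ + 2)) → ℝ :=
    fun p i => ∑ j, σ (p.1 j) * p.2 i (some j) + p.2 i none with hG
  have hGm : Measurable G := by
    refine measurable_pi_lambda _ fun i => ?_
    simp only [hG]
    fun_prop
  have e1 : ∀ ω, randomLayer n σ v b x (ℓ + 1) ω
      = G (randomLayer n σ v b x ℓ ω, neuronData v b (ℓ + 1) ω) := fun ω => by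
    ext i
    rw [randomLayer_succ]
    rfl
  have e2 : ∀ z : Fin (n (ℓ + 1)) → ℝ, ∫ t, Ψ (G (z, t)) ∂(P.map (neuronData v b (ℓ + 1)))
      = ∫ y, Ψ y ∂Measure.pi (fun _ => rowLaw (lam (ℓ + 1)) cb fun j => σ (z j)) := fun z => by
    rw [integral_pi_rowLaw (lam (ℓ + 1)) cb hΨ, hlaw]
  have hint : Integrable (fun p => Ψ (G p)) ((P.map (randomLayer n σ v b x ℓ)).prod
      (P.map (neuronData v b (ℓ + 1)))) :=
    integrable_of_measurable_of_abs_le (hΨ.comp hGm) fun _ => hB _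
  simp only [e1, ← e2]
  rw [← integral_map (μ := P) (φ := fun ω => (randomLayer n σ v b x ℓ ω, neuronData v b (ℓ + 1) ω))
    (f := fun p => Ψ (G p)) (hz.prodMk hT).aemeasurable (hΨ.comp hGm).aestronglyMeasurable, hprod,
    integral_prod _ hint,
    integral_map hz.aemeasurable]
  exact (StronglyMeasurable.integral_prod_right (f := fun z t => Ψ (G (z, t)))
    (hΨ.comp hGm).stronglyMeasurable).aestronglyMeasurable

end

/-! ### Exchanging the weights of one neuron -/

/-- The law of a weight with variance `v`, up to the distribution `μ` of the standardized weight. -/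
noncomputable def scaledLaw (μ : Measure ℝ) (v : ℝ) : Measure ℝ := μ.map fun t => √v * t

instance isProbabilityMeasure_scaledLaw (μ : Measure ℝ) [IsProbabilityMeasure μ] (v : ℝ) :
    IsProbabilityMeasure (scaledLaw μ v) :=
  Measure.isProbabilityMeasure_map (measurable_const_mul _).aemeasurable

theorem scaledLaw_gaussianReal (v : ℝ≥0) :
    scaledLaw (gaussianReal 0 1) v = gaussianReal 0 v := by
  rw [scaledLaw, gaussianReal_map_const_mul, mul_zero, mul_one]
  congr 1
  ext
  exact Real.sq_sqrt v.2

/-- The source of the rate: `n` exchanges, each costing the cube of the typical size of a weight. -/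
theorem natCast_mul_sqrt_div_pow_three {n : ℕ} (hn : 0 < n) (c : ℝ≥0) :
    (n : ℝ) * √(c / n) ^ 3 = c * √c / √n := by
  have hn' : (0 : ℝ) < n := by exact_mod_cast hn
  have h1 : √(c / n : ℝ) ^ 2 = c / n := Real.sq_sqrt (by positivity)
  have h2 : √(c / n : ℝ) = √c / √n := Real.sqrt_div c.2 _
  rw [pow_succ, h1, h2]
  field_simp

section Swap

variable {μ : Measure ℝ}

/-- The factor in the Lindeberg bound for a single neuron. -/
noncomputable def lindebergConst (μ : Measure ℝ) (S : ℝ) (CW : ℝ≥0) : ℝ :=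
  S ^ 3 * (CW * √CW) * (∫ t, |t| ^ 3 ∂μ + ∫ t, |t| ^ 3 ∂gaussianReal 0 1)

theorem lindebergConst_nonneg {S : ℝ} (hS : 0 ≤ S) (CW : ℝ≥0) : 0 ≤ lindebergConst μ S CW := by
  have h1 : 0 ≤ ∫ t, |t| ^ 3 ∂μ := integral_nonneg fun t => by positivity
  have h2 : 0 ≤ ∫ t, |t| ^ 3 ∂gaussianReal 0 1 := integral_nonneg fun t => by positivity
  unfold lindebergConst
  positivity

variable [IsProbabilityMeasure μ]

theorem abs_integral_scaledLaw_sub_le (hμ : IsStandard μ) {n : ℕ} (hn : 0 < n) (CW : ℝ≥0)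
    {H : ℝ → ℝ} (hH : Measurable H) {B M S : ℝ} (hB : ∀ x, |H x| ≤ B) (hT : TaylorThree H M)
    (hM : 0 ≤ M) (s : Fin n → ℝ) (hs : ∀ j, |s j| ≤ S) (x : ℝ) :
    |∫ r, H (x + ∑ j, s j * r j) ∂Measure.pi (fun _ : Fin n => scaledLaw μ (CW / n))
      - ∫ r, H (x + ∑ j, s j * r j)
        ∂Measure.pi (fun _ : Fin n => scaledLaw (gaussianReal 0 1) (CW / n))|
    ≤ M * lindebergConst μ S CW / √n := by
  refine (abs_integral_pi_lindeberg hμ isStandard_gaussianReal hH hB hT hM (Real.sqrt_nonneg _)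
    s hs x).trans (le_of_eq ?_)
  rw [Fintype.card_fin, lindebergConst]
  calc _ = M * S ^ 3 * ((n : ℝ) * √(CW / n) ^ 3) *
        (∫ t, |t| ^ 3 ∂μ + ∫ t, |t| ^ 3 ∂gaussianReal 0 1) := by ring
    _ = _ := by rw [natCast_mul_sqrt_div_pow_three hn]; ring

/-- For exchanges in a hidden layer, where the later Gaussian layers have made the test function
smooth. -/
theorem abs_integral_rowLaw_sub_le_of_taylorThree (hμ : IsStandard μ) {n : ℕ} (hn : 0 < n)
    (CW cb : ℝ≥0) {H : ℝ → ℝ} (hH : Measurable H) {B M S : ℝ} (hB : ∀ x, |H x| ≤ B)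
    (hT : TaylorThree H M) (hM : 0 ≤ M) (s : Fin n → ℝ) (hs : ∀ j, |s j| ≤ S) :
    |∫ y, H y ∂rowLaw (scaledLaw μ (CW / n)) cb s
      - ∫ y, H y ∂rowLaw (scaledLaw (gaussianReal 0 1) (CW / n)) cb s|
    ≤ M * lindebergConst μ S CW / √n := by
  have hint : ∀ (lam : Measure ℝ) [IsProbabilityMeasure lam],
      Integrable (fun b => ∫ a, H (∑ j, s j * a j + b) ∂Measure.pi (fun _ : Fin n => lam))
        (gaussianReal 0 cb) := fun lam _ =>
    integrable_of_measurable_of_abs_le (StronglyMeasurable.integral_prod_right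
      (f := fun (b : ℝ) (a : Fin n → ℝ) => H (∑ j, s j * a j + b))
      (hH.comp (by fun_prop)).stronglyMeasurable).measurable
      fun b => abs_integral_le_of_abs_le fun a => hB _
  rw [(integral_rowLaw _ cb s hH hB).2, (integral_rowLaw _ cb s hH hB).2]
  refine abs_integral_sub_integral_le (hint _) (hint _) fun b => ?_
  simp only [add_comm _ b]
  exact abs_integral_scaledLaw_sub_le hμ hn CW hH hB hT hM s hs b

/-- For exchanges in the output layer, where only the bias can smooth the test function. -/
theorem abs_integral_rowLaw_sub_le_of_osc (hμ : IsStandard μ) {S : ℝ} (hS : 0 ≤ S)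
    (CW : ℝ≥0) {cb : ℝ≥0} (hcb : 0 < cb) :
    ∃ C : ℝ, 0 ≤ C ∧ ∀ {n : ℕ}, 0 < n → ∀ (h : ℝ → ℝ) (A B : ℝ), Measurable h → 0 ≤ A →
      (∀ x, |h x| ≤ B) → (∀ x y, |h x - h y| ≤ A * (1 + |x - y|)) →
      ∀ s : Fin n → ℝ, (∀ j, |s j| ≤ S) →
      |∫ y, h y ∂rowLaw (scaledLaw μ (CW / n)) cb s
        - ∫ y, h y ∂rowLaw (scaledLaw (gaussianReal 0 1) (CW / n)) cb s| ≤ C * A / √n := by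
  obtain ⟨C, hC, H⟩ := taylorThree_gaussian_smoothing hcb
  refine ⟨C * lindebergConst μ S CW, mul_nonneg hC (lindebergConst_nonneg hS CW),
    fun {n} hn h A B hh hA hB hosc s hs => ?_⟩
  have hT := H h A B hh hA hB hosc
  have hm : Measurable fun x => ∫ b, h (x + b) ∂gaussianReal 0 cb :=
    (StronglyMeasurable.integral_prod_right (f := fun x b => h (x + b))
      (hh.comp (by fun_prop)).stronglyMeasurable).measurable
  rw [(integral_rowLaw _ cb s hh hB).1, (integral_rowLaw _ cb s hh hB).1]
  have := abs_integral_scaledLaw_sub_le hμ hn CW hm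
    (fun x => abs_integral_le_of_abs_le fun b => hB (x + b)) hT (by positivity) s hs 0
  simp only [zero_add] at this
  exact this.trans (le_of_eq (by ring))

end Swap

/-- A Gaussian layer sees its input only through one scalar variance; this reduces the later layers
to functions of a real variable. -/
theorem integral_pi_rowLaw_gaussianReal {ι : Type*} [Fintype ι] {n : ℕ} (CW cb : ℝ≥0)
    {σ : ℝ → ℝ} {Ψ : (ι → ℝ) → ℝ} (hΨ : Measurable Ψ) (z : Fin n → ℝ) :
    ∫ y, Ψ y ∂Measure.pi (fun _ => rowLaw (scaledLaw (gaussianReal 0 1) (CW / n)) cb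
      fun j => σ (z j)) = gaussAvg Ψ (layerVar CW cb (fun x => σ x ^ 2) z) := by
  have h1 : (CW : ℝ) / n = ((CW / n : ℝ≥0) : ℝ) := by push_cast; rfl
  rw [gaussAvg_eq_integral hΨ, h1, scaledLaw_gaussianReal]
  simp only [rowLaw_gaussianReal]
  congr 3
  ext1 _
  congr 1
  ext
  rw [Real.coe_toNNReal]
  · rw [layerVar, ← Finset.sum_mul, Fintype.card_fin]
    push_cast
    simp only [Real.norm_eq_abs, sq_abs]
    ring
  · unfold layerVar
    positivity

/-! ### Exchanging a layer and propagating through Gaussian layers -/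

/-- Weights `w` in the layers `< m`, weights `g` in the other ones. -/
def mixedWeight {Ω : Type*} {n : ℕ → ℕ} (w g : (ℓ : ℕ) → Fin (n (ℓ + 1)) → Fin (n ℓ) → Ω → ℝ)
    (m ℓ : ℕ) (i : Fin (n (ℓ + 1))) (j : Fin (n ℓ)) (ω : Ω) : ℝ :=
  if ℓ + 1 ≤ m then w ℓ i j ω else g ℓ i j ω

/-- The law of the entries of `mixedWeight w g m`. -/
noncomputable def mixedLaw (μ : Measure ℝ) (CW : ℝ≥0) (n : ℕ → ℕ) (m ℓ : ℕ) : Measure ℝ :=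
  scaledLaw (if 1 ≤ ℓ ∧ ℓ + 1 ≤ m then μ else gaussianReal 0 1) (CW / n ℓ)

instance isProbabilityMeasure_mixedLaw (μ : Measure ℝ) [IsProbabilityMeasure μ] (CW : ℝ≥0)
    (n : ℕ → ℕ) (m ℓ : ℕ) : IsProbabilityMeasure (mixedLaw μ CW n m ℓ) := by
  unfold mixedLaw
  split_ifs <;> infer_instance

theorem randomLayer_congr {Ω : Type*} {n : ℕ → ℕ} {σ : ℝ → ℝ}
    {v v' : (ℓ : ℕ) → Fin (n (ℓ + 1)) → Fin (n ℓ) → Ω → ℝ}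
    {b b' : (ℓ : ℕ) → Fin (n (ℓ + 1)) → Ω → ℝ} {x : Fin (n 0) → ℝ} {ω : Ω} {ℓ : ℕ}
    (hv : ∀ ℓ' ≤ ℓ, ∀ i j, v ℓ' i j ω = v' ℓ' i j ω) (hb : ∀ ℓ' ≤ ℓ, ∀ i, b ℓ' i ω = b' ℓ' i ω) :
    randomLayer n σ v b x ℓ ω = randomLayer n σ v' b' x ℓ ω := by
  induction ℓ with
  | zero =>
    ext i
    simp only [randomLayer_zero, hv 0 le_rfl, hb 0 le_rfl]
  | succ ℓ ih =>
    ext i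
    simp only [randomLayer_succ, hv _ le_rfl, hb _ le_rfl,
      ih (fun ℓ' h => hv ℓ' (by omega)) (fun ℓ' h => hb ℓ' (by omega))]

section

variable {Ω : Type*} [MeasurableSpace Ω] {P : Measure Ω} [IsProbabilityMeasure P] {L : ℕ}
  {n : ℕ → ℕ} {σ : ℝ → ℝ} {CW cb : ℝ≥0} {μ : Measure ℝ} [IsProbabilityMeasure μ]
  {w g : (ℓ : ℕ) → Fin (n (ℓ + 1)) → Fin (n ℓ) → Ω → ℝ}
  {b : (ℓ : ℕ) → Fin (n (ℓ + 1)) → Ω → ℝ} {x : Fin (n 0) → ℝ}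

theorem integral_layer_succ_of_le {m : ℕ}
    (h : IsIndepNetwork P L n (mixedLaw μ CW n m) cb (mixedWeight w g m) b) (hσ : Measurable σ)
    {ℓ : ℕ} (hℓ : ℓ + 1 ≤ L) (hm : m ≤ ℓ + 1) {Ψ : (Fin (n (ℓ + 2)) → ℝ) → ℝ} (hΨ : Measurable Ψ)
    {B : ℝ} (hB : ∀ y, |Ψ y| ≤ B) :
    ∫ ω, Ψ (randomLayer n σ (mixedWeight w g m) b x (ℓ + 1) ω) ∂P
      = ∫ ω, gaussAvg Ψ (layerVar CW cb (fun x => σ x ^ 2)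
          (randomLayer n σ (mixedWeight w g m) b x ℓ ω)) ∂P := by
  rw [h.integral_layer_succ hσ hℓ hΨ hB, mixedLaw, if_neg (by omega)]
  simp only [integral_pi_rowLaw_gaussianReal CW cb hΨ]

/-- The two networks coincide up to index `k`, so conditioning yields the same `z` in both. Only the
row laws at index `k + 1` differ, and these are exchanged neuron by neuron. -/
theorem abs_integral_sub_le_of_rows {k : ℕ} (hk : k + 1 ≤ L)
    (h1 : IsIndepNetwork P L n (mixedLaw μ CW n (k + 2)) cb (mixedWeight w g (k + 2)) b)
    (h0 : IsIndepNetwork P L n (mixedLaw μ CW n (k + 1)) cb (mixedWeight w g (k + 1)) b)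
    (hσ : Measurable σ) {Ψ : (Fin (n (k + 2)) → ℝ) → ℝ} (hΨ : Measurable Ψ)
    {B ε : ℝ} (hB : ∀ y, |Ψ y| ≤ B)
    (hε : ∀ (z : Fin (n (k + 1)) → ℝ) (i : Fin (n (k + 2))) (a : Fin (n (k + 2)) → ℝ),
      |∫ t, Ψ (Function.update a i t) ∂rowLaw (scaledLaw μ (CW / n (k + 1))) cb (fun j => σ (z j))
        - ∫ t, Ψ (Function.update a i t)
          ∂rowLaw (scaledLaw (gaussianReal 0 1) (CW / n (k + 1))) cb (fun j => σ (z j))| ≤ ε) :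
    |∫ ω, Ψ (randomLayer n σ (mixedWeight w g (k + 2)) b x (k + 1) ω) ∂P
      - ∫ ω, Ψ (randomLayer n σ (mixedWeight w g (k + 1)) b x (k + 1) ω) ∂P| ≤ n (k + 2) * ε := by
  have heq : ∀ ω, randomLayer n σ (mixedWeight w g (k + 2)) b x k ω
      = randomLayer n σ (mixedWeight w g (k + 1)) b x k ω := fun ω =>
    randomLayer_congr (fun ℓ' h i j => by
      rw [mixedWeight, mixedWeight, if_pos (by omega), if_pos (by omega)]) fun _ _ _ => rfl
  rw [h1.integral_layer_succ hσ hk hΨ hB, h0.integral_layer_succ hσ hk hΨ hB]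
  simp only [heq]
  rw [mixedLaw, mixedLaw, if_pos (by omega), if_neg (by omega)]
  have hz := h0.measurable_layer (x := x) hσ k
  have hint : ∀ (lam : Measure ℝ) [IsProbabilityMeasure lam], Integrable (fun ω => ∫ y, Ψ y
      ∂Measure.pi (fun _ => rowLaw lam cb
        fun j => σ (randomLayer n σ (mixedWeight w g (k + 1)) b x k ω j))) P := fun lam _ =>
    integrable_of_measurable_of_abs_le ((measurable_integral_pi_rowLaw lam cb hΨ).comp
      (measurable_pi_lambda _ fun j => hσ.comp ((measurable_pi_apply j).comp hz)))
      fun ω => abs_integral_le_of_abs_le hB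
  refine abs_integral_sub_integral_le (hint _) (hint _) fun ω => ?_
  set z := randomLayer n σ (mixedWeight w g (k + 1)) b x k ω
  refine (abs_integral_pi_sub_integral_pi_le
    (fun _ => rowLaw (scaledLaw μ (CW / n (k + 1))) cb fun j => σ (z j))
    (fun _ => rowLaw (scaledLaw (gaussianReal 0 1) (CW / n (k + 1))) cb fun j => σ (z j))
    hΨ hB (fun _ => ε) fun i a => hε z i a).trans ?_
  simp

/-- Induction on the number `j` of Gaussian layers after the exchanged one up to the layer inside
`layerVar`. Integrating out the last of them replaces `Φ` by the Gaussian mean of `Φ ∘ layerVar` and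
costs a factor `C2`. -/
theorem abs_integral_layerVar_sub_le {S hi : ℝ} (hσ : Measurable σ) (hσS : ∀ t, |σ t| ≤ S)
    (hμ : IsStandard μ) (hcb : 0 < cb)
    (hhi : cb + CW * S ^ 2 < hi) {C1 C2 : ℝ} (hC1 : 0 ≤ C1)
    (hT : ∀ (n : ℕ), 0 < n → ∀ (Φ : ℝ → ℝ) (M : ℝ),
      SmoothBdd (Set.Ioo ((cb : ℝ) / 2) hi) Φ M → ∀ (a : Fin n → ℝ) (i : Fin n),
      TaylorThree (fun t => Φ (layerVar CW cb (fun t => σ t ^ 2) (Function.update a i t)))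
        (C1 * M / n))
    (hG : ∀ (n : ℕ), 0 < n → ∀ (Φ : ℝ → ℝ) (M B : ℝ), Measurable Φ →
      (∀ q, |Φ q| ≤ B) → SmoothBdd (Set.Ioo ((cb : ℝ) / 2) hi) Φ M →
      SmoothBdd (Set.Ioo ((cb : ℝ) / 2) hi)
        (gaussAvg fun y : Fin n → ℝ => Φ (layerVar CW cb (fun t => σ t ^ 2) y)) (C2 * M))
    (hn : ∀ ℓ ≤ L + 1, 0 < n ℓ) {k : ℕ}
    (h1 : IsIndepNetwork P L n (mixedLaw μ CW n (k + 2)) cb (mixedWeight w g (k + 2)) b)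
    (h0 : IsIndepNetwork P L n (mixedLaw μ CW n (k + 1)) cb (mixedWeight w g (k + 1)) b)
    (j : ℕ) (hj : k + j + 1 ≤ L) (Φ : ℝ → ℝ) (M B : ℝ) (hΦ : Measurable Φ) (hB : ∀ q, |Φ q| ≤ B)
    (hΦs : SmoothBdd (Set.Ioo ((cb : ℝ) / 2) hi) Φ M) :
    |∫ ω, Φ (layerVar CW cb (fun t => σ t ^ 2)
        (randomLayer n σ (mixedWeight w g (k + 2)) b x (k + j + 1) ω)) ∂P
      - ∫ ω, Φ (layerVar CW cb (fun t => σ t ^ 2)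
        (randomLayer n σ (mixedWeight w g (k + 1)) b x (k + j + 1) ω)) ∂P|
      ≤ C1 * C2 ^ j * M * lindebergConst μ S CW / √(n (k + 1)) := by
  have hlv : ∀ m : ℕ, Measurable (layerVar (ι := Fin m) CW cb fun t => σ t ^ 2) := fun _ =>
    measurable_layerVar (hσ.pow_const 2)
  have hM : ∀ {Φ : ℝ → ℝ} {M : ℝ}, SmoothBdd (Set.Ioo ((cb : ℝ) / 2) hi) Φ M → 0 ≤ M := by
    rintro Φ M ⟨f1, f2, f3, -, hb⟩
    have hcb' : (0 : ℝ) < cb := by exact_mod_cast hcb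
    have : 0 ≤ (CW : ℝ) * S ^ 2 := by positivity
    exact (abs_nonneg _).trans (hb cb ⟨by linarith, by linarith⟩).1
  induction j generalizing Φ M with
  | zero =>
    have hm0 : 0 < n (k + 2) := hn _ (by omega)
    have hm : (0 : ℝ) < n (k + 2) := by exact_mod_cast hm0
    have hM0 := hM hΦs
    refine (abs_integral_sub_le_of_rows (x := x) hj h1 h0 hσ (hΦ.comp (hlv _)) (fun y => hB _)
      (ε := C1 * M / n (k + 2) * lindebergConst μ S CW / √(n (k + 1)))
      fun z i a => ?_).trans (le_of_eq ?_)
    · exact abs_integral_rowLaw_sub_le_of_taylorThree hμ (hn (k + 1) (by omega)) CW cb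
        ((hΦ.comp (hlv _)).comp (measurable_update a)) (fun t => hB _) (hT _ hm0 Φ M hΦs a i)
        (by positivity) _ fun j => hσS _
    -- The number `n (k + 2)` of neurons cancels against the factor `1 / n (k + 2)` in the Taylor
    -- bound of each of them.
    · field_simp
  | succ j ih =>
    have e1 := integral_layer_succ_of_le (x := x) h1 hσ (ℓ := k + j + 1) hj (by omega)
      (hΦ.comp (hlv _)) (fun y => hB _)
    have e0 := integral_layer_succ_of_le (x := x) h0 hσ (ℓ := k + j + 1) hj (by omega)
      (hΦ.comp (hlv _)) (fun y => hB _)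
    have := ih (by omega) _ (C2 * M) (measurable_gaussAvg (hΦ.comp (hlv _)))
      (fun q => abs_gaussAvg_le (fun y => hB _) q)
      (hG _ (hn (k + j + 3) (by omega)) Φ M B hΦ hB hΦs)
    simp only [Function.comp_def] at e1 e0 this
    rw [← e1, ← e0] at this
    exact this.trans (le_of_eq (by ring))

end

/-! ### The activation and its square -/

theorem HasJet.sq {I : Set ℝ} {f f1 f2 f3 : ℝ → ℝ} (hf : HasJet I f f1 f2 f3) :
    HasJet I (fun x => f x ^ 2) (fun x => 2 * f x * f1 x) (fun x => 2 * f1 x ^ 2 + 2 * f x * f2 x)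
      (fun x => 6 * f1 x * f2 x + 2 * f x * f3 x) where
  d1 x hx := ((hf.d1 x hx).fun_pow 2).congr_deriv (by push_cast; ring)
  d2 x hx := (((hf.d1 x hx).const_mul 2).mul (hf.d2 x hx)).congr_deriv (by ring)
  d3 x hx := ((((hf.d2 x hx).fun_pow 2).const_mul 2).add
    (((hf.d1 x hx).const_mul 2).mul (hf.d3 x hx))).congr_deriv (by push_cast; ring)

theorem SmoothBdd.sq {I : Set ℝ} {f : ℝ → ℝ} {M : ℝ} (hf : SmoothBdd I f M)
    (h0 : ∀ x ∈ I, |f x| ≤ M) : SmoothBdd I (fun x => f x ^ 2) (8 * M ^ 2) := by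
  obtain ⟨f1, f2, f3, hj, hb⟩ := hf
  refine ⟨_, _, _, hj.sq, fun x hx => ?_⟩
  obtain ⟨b1, b2, b3⟩ := hb x hx
  have b0 := h0 x hx
  have hM : 0 ≤ M := (abs_nonneg _).trans b0
  have hmul : ∀ {a b : ℝ}, |a| ≤ M → |b| ≤ M → |a * b| ≤ M ^ 2 := fun ha hb => by
    rw [abs_mul, pow_two]; gcongr
  have m1 := abs_le.1 (hmul b0 b1)
  have m2 := abs_le.1 (hmul b1 b1)
  have m3 := abs_le.1 (hmul b0 b2)
  have m4 := abs_le.1 (hmul b1 b2)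
  have m5 := abs_le.1 (hmul b0 b3)
  have hM2 : 0 ≤ M ^ 2 := by positivity
  simp only [abs_le]
  refine ⟨⟨?_, ?_⟩, ⟨?_, ?_⟩, ?_, ?_⟩ <;> nlinarith

theorem IsCb.smoothBdd {σ : ℝ → ℝ} (hσ : IsCb 3 σ) :
    ∃ S : ℝ, (∀ t, |σ t| ≤ S) ∧ SmoothBdd Set.univ σ S := by
  obtain ⟨hc, hb⟩ := hσ
  obtain ⟨B0, h0⟩ := hb 0 (by norm_num)
  obtain ⟨B1, h1⟩ := hb 1 (by norm_num)
  obtain ⟨B2, h2⟩ := hb 2 (by norm_num)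
  obtain ⟨B3, h3⟩ := hb 3 (by norm_num)
  simp only [norm_iteratedFDeriv_eq_norm_iteratedDeriv, Real.norm_eq_abs] at h0 h1 h2 h3
  have hd : ∀ k : ℕ, k < 3 → ∀ x, HasDerivAt (iteratedDeriv k σ) (iteratedDeriv (k + 1) σ x) x :=
    fun k hk x => by
      rw [iteratedDeriv_succ]
      exact (hc.differentiable_iteratedDeriv k (by exact_mod_cast hk) x).hasDerivAt
  refine ⟨max (max B0 B1) (max B2 B3), fun t => ?_, iteratedDeriv 1 σ, iteratedDeriv 2 σ,
    iteratedDeriv 3 σ, ⟨fun t _ => ?_, fun t _ => hd 1 (by norm_num) t,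
      fun t _ => hd 2 (by norm_num) t⟩, fun t _ => ⟨?_, ?_, ?_⟩⟩
  · have := h0 t
    rw [iteratedDeriv_zero] at this
    exact this.trans (by simp)
  · have := hd 0 (by norm_num) t
    rwa [iteratedDeriv_zero] at this
  · exact (h1 t).trans (by simp)
  · exact (h2 t).trans (by simp)
  · exact (h3 t).trans (by simp)

/-! ### Absolute continuity of the layers -/

theorem pi_absolutelyContinuous_pi {m : ℕ} {α β : Fin m → Measure ℝ} [∀ i, SigmaFinite (α i)]
    [∀ i, SigmaFinite (β i)] (h : ∀ i, α i ≪ β i) : Measure.pi α ≪ Measure.pi β := by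
  induction m with
  | zero => rw [Measure.pi_of_empty, Measure.pi_of_empty]
  | succ m ih =>
    rw [← (measurePreserving_piFinSuccAbove α 0).symm.map_eq,
      ← (measurePreserving_piFinSuccAbove β 0).symm.map_eq]
    exact ((h 0).prod (ih fun i => h _)).map (MeasurableEquiv.measurable _)

/-- Conditioning is applied to an indicator; given the preceding layer, the law is a product of
absolutely continuous row laws. Hence changing `F` on a null set does not affect its expectations.
-/
theorem IsIndepNetwork.measure_layer_succ_eq_zero {Ω : Type*} [MeasurableSpace Ω] {P : Measure Ω}
    [IsProbabilityMeasure P] {L : ℕ} {n : ℕ → ℕ} {σ : ℝ → ℝ} {cb : ℝ≥0} {lam : ℕ → Measure ℝ}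
    [∀ ℓ, IsProbabilityMeasure (lam ℓ)] {v : (ℓ : ℕ) → Fin (n (ℓ + 1)) → Fin (n ℓ) → Ω → ℝ}
    {b : (ℓ : ℕ) → Fin (n (ℓ + 1)) → Ω → ℝ} {x : Fin (n 0) → ℝ}
    (h : IsIndepNetwork P L n lam cb v b) (hcb : 0 < cb) (hσ : Measurable σ) {ℓ : ℕ}
    (hℓ : ℓ + 1 ≤ L) {N : Set (Fin (n (ℓ + 2)) → ℝ)} (hN : MeasurableSet N) (h0 : volume N = 0) :
    P (randomLayer n σ v b x (ℓ + 1) ⁻¹' N) = 0 := by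
  have hm : Measurable (N.indicator fun _ => (1 : ℝ)) := measurable_const.indicator hN
  have hB : ∀ y, |N.indicator (fun _ => (1 : ℝ)) y| ≤ 1 := fun y => by
    by_cases hy : y ∈ N <;> simp [hy]
  have e := h.integral_layer_succ (x := x) hσ hℓ hm hB
  have e0 : ∀ s : Fin (n (ℓ + 1)) → ℝ, ∫ y, N.indicator (fun _ => (1 : ℝ)) y
      ∂Measure.pi (fun _ => rowLaw (lam (ℓ + 1)) cb s) = 0 := fun s => by
    rw [integral_indicator hN, setIntegral_const, smul_eq_mul, mul_one, measureReal_def]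
    rw [pi_absolutelyContinuous_pi (fun _ => rowLaw_absolutelyContinuous _ hcb.ne' s) h0]
    rfl
  simp only [e0, integral_zero] at e
  have hz := h.measurable_layer (x := x) hσ (ℓ + 1)
  have e1 : ∫ ω, N.indicator (fun _ => (1 : ℝ)) (randomLayer n σ v b x (ℓ + 1) ω) ∂P
      = P.real (randomLayer n σ v b x (ℓ + 1) ⁻¹' N) := by
    rw [← integral_indicator_one (hz hN)]
    rfl
  rw [e1, measureReal_eq_zero_iff] at e
  exact e

/-! ### The bound for functions of controlled oscillation -/

theorem exists_bound_of_osc (L d : ℕ) {σ : ℝ → ℝ} (hσ : IsCb 3 σ) (CW : ℝ≥0) {cb : ℝ≥0}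
    (hcb : 0 < cb) {μ : Measure ℝ} [IsProbabilityMeasure μ] (hμ : IsStandard μ) :
    ∃ C : ℝ, 0 ≤ C ∧ ∀ (n : ℕ → ℕ), n (L + 1) = d → (∀ ℓ ≤ L + 1, 0 < n ℓ) →
      ∀ (Ω : Type*) [MeasurableSpace Ω] (P : Measure Ω) [IsProbabilityMeasure P]
        (w g : (ℓ : ℕ) → Fin (n (ℓ + 1)) → Fin (n ℓ) → Ω → ℝ)
        (b : (ℓ : ℕ) → Fin (n (ℓ + 1)) → Ω → ℝ) (x : Fin (n 0) → ℝ) (k : ℕ), k + 1 ≤ L →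
        IsIndepNetwork P L n (mixedLaw μ CW n (k + 2)) cb (mixedWeight w g (k + 2)) b →
        IsIndepNetwork P L n (mixedLaw μ CW n (k + 1)) cb (mixedWeight w g (k + 1)) b →
      ∀ (F : (Fin (n (L + 1)) → ℝ) → ℝ) (A B : ℝ), Measurable F → 0 ≤ A → (∀ y, |F y| ≤ B) →
        (∀ y y', |F y - F y'| ≤ A * (1 + ∑ i, |y i - y' i|)) →
        |∫ ω, F (randomLayer n σ (mixedWeight w g (k + 2)) b x L ω) ∂P
          - ∫ ω, F (randomLayer n σ (mixedWeight w g (k + 1)) b x L ω) ∂P|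
          ≤ C * A / √(n (k + 1)) := by
  have hcb' : (0 : ℝ) < cb := by exact_mod_cast hcb
  have hσm : Measurable σ := hσ.1.continuous.measurable
  obtain ⟨S, hS, hσS⟩ := hσ.smoothBdd
  have hS0 : 0 ≤ S := (abs_nonneg _).trans (hS 0)
  have hs2 := hσS.sq fun t _ => hS t
  have hs0 : ∀ t, 0 ≤ σ t ^ 2 := fun t => sq_nonneg _
  have hsS : ∀ t, σ t ^ 2 ≤ S ^ 2 := fun t => sq_le_sq' (abs_le.1 (hS t)).1 (abs_le.1 (hS t)).2
  -- All values of `layerVar` lie in `[cb, cb + CW * S ^ 2]`; the open interval from `cb / 2` to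
  -- `hi` contains this range and stays away from zero.
  set hi : ℝ := cb + CW * S ^ 2 + 1 with hhi
  have hhi' : cb + CW * S ^ 2 < hi := by linarith
  have hlt : (cb : ℝ) / 2 < hi := by
    have : 0 ≤ (CW : ℝ) * S ^ 2 := by positivity
    linarith
  obtain ⟨C0, hC0, H0⟩ := smoothBdd_gaussAvg (Fin d) (half_pos hcb') hlt
  obtain ⟨C1, hC1, H1⟩ := taylorThree_comp_layerVar CW.2 hcb' hs0 hsS hhi' hs2
  obtain ⟨C2, hC2, H2⟩ := smoothBdd_gaussAvg_comp_layerVar CW.2 hcb' hs0 hsS hhi' hs2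
  obtain ⟨C3, hC3, H3⟩ := abs_integral_rowLaw_sub_le_of_osc hμ hS0 CW hcb
  have hK := lindebergConst_nonneg (μ := μ) hS0 CW
  refine ⟨d * C3 + C1 * (1 + C2) ^ L * C0 * lindebergConst μ S CW, by positivity,
    fun n hd hn Ω _ P _ w g b x k hk h1 h0 F A B hF hA hB hosc => ?_⟩
  subst hd
  -- In the case of equality the output layer is exchanged, and its `d` neurons contribute the term
  -- `d * C3`. Otherwise at least one Gaussian layer follows.
  rcases hk.eq_or_lt with rfl | hlt
  · refine (abs_integral_sub_le_of_rows (x := x) le_rfl h1 h0 hσm hF hB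
      (ε := C3 * A / √(n (k + 1))) fun z i a => ?_).trans ?_
    · refine H3 (hn (k + 1) (by omega)) (fun t => F (Function.update a i t)) A B
        (hF.comp (measurable_update a)) hA (fun t => hB _) (fun t t' => ?_) _ fun j => hS _
      refine (hosc _ _).trans (le_of_eq ?_)
      rw [Finset.sum_eq_single i (fun j _ hj => by simp [hj]) (by simp)]
      simp
    · rw [← mul_div_assoc]
      refine div_le_div_of_nonneg_right ?_ (Real.sqrt_nonneg _)
      have : 0 ≤ C1 * (1 + C2) ^ (k + 1) * C0 * lindebergConst μ S CW * A := by positivity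
      linarith
  · obtain ⟨j, rfl⟩ : ∃ j, L = k + j + 2 := ⟨L - k - 2, by omega⟩
    have e1 := integral_layer_succ_of_le (x := x) h1 hσm (ℓ := k + j + 1) le_rfl (by omega) hF hB
    have e0 := integral_layer_succ_of_le (x := x) h0 hσm (ℓ := k + j + 1) le_rfl (by omega) hF hB
    rw [e1, e0]
    refine (abs_integral_layerVar_sub_le hσm hS hμ hcb hhi' hC1 H1 H2 hn h1 h0 j (by omega) _
      (C0 * A) B (measurable_gaussAvg hF) (fun q => abs_gaussAvg_le hB q)
      (H0 F A B hF hA hB hosc)).trans ?_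
    refine div_le_div_of_nonneg_right ?_ (Real.sqrt_nonneg _)
    -- Passing to `1 + C2` gives one constant for all positions of the exchanged layer, whether or
    -- not `C2` exceeds one.
    have e : C2 ^ j ≤ (1 + C2) ^ (k + j + 2) :=
      (pow_le_pow_left₀ hC2 (by linarith) j).trans
        (pow_le_pow_right₀ (by linarith) (by omega))
    calc C1 * C2 ^ j * (C0 * A) * lindebergConst μ S CW
        ≤ C1 * (1 + C2) ^ (k + j + 2) * (C0 * A) * lindebergConst μ S CW := by gcongr
      _ ≤ n (k + j + 2 + 1) * C3 * A
          + C1 * (1 + C2) ^ (k + j + 2) * (C0 * A) * lindebergConst μ S CW :=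
        le_add_of_nonneg_left (by positivity)
      _ = _ := by ring

/-! ### Measurable versions and conclusion -/

/-- `HasLaw` only gives almost everywhere measurability. One choice of versions serves all `m`, so
that networks with different `m` still share their common layers. -/
theorem IsRandomInit.exists_measurable {Ω : Type*} [MeasurableSpace Ω] {P : Measure Ω} {L : ℕ}
    {n : ℕ → ℕ} {CW cb : ℝ≥0} {μ : Measure ℝ}
    {w g : (ℓ : ℕ) → Fin (n (ℓ + 1)) → Fin (n ℓ) → Ω → ℝ}
    {b : (ℓ : ℕ) → Fin (n (ℓ + 1)) → Ω → ℝ} (h : IsRandomInit P L n CW cb μ w g b) :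
    ∃ (w' g' : (ℓ : ℕ) → Fin (n (ℓ + 1)) → Fin (n ℓ) → Ω → ℝ)
      (b' : (ℓ : ℕ) → Fin (n (ℓ + 1)) → Ω → ℝ),
      (∀ m, 1 ≤ m → IsIndepNetwork P L n (mixedLaw μ CW n m) cb (mixedWeight w' g' m) b') ∧
      ∀ᵐ ω ∂P, ∀ ℓ ≤ L, (∀ i j, w ℓ i j ω = w' ℓ i j ω ∧ g ℓ i j ω = g' ℓ i j ω) ∧
        ∀ i, b ℓ i ω = b' ℓ i ω := by
  -- The default `0` covers the unconstrained layers beyond `L`, since `IsIndepNetwork` asks for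
  -- measurability at every index.
  have hex : ∀ f : Ω → ℝ, ∃ f' : Ω → ℝ, Measurable f' ∧ (AEMeasurable f P → f =ᵐ[P] f') := by
    intro f
    by_cases hf : AEMeasurable f P
    · exact ⟨hf.mk f, hf.measurable_mk, fun _ => hf.ae_eq_mk⟩
    · exact ⟨0, measurable_zero, fun h => absurd h hf⟩
  choose mk hmk hae using hex
  have hlw : ∀ ℓ ≤ L, ∀ i j, HasLaw (w ℓ i j)
      (scaledLaw (if 1 ≤ ℓ then μ else gaussianReal 0 1) (CW / n ℓ)) P := fun ℓ hℓ i j => by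
    rcases Nat.eq_zero_or_pos ℓ with rfl | h0
    · have := scaledLaw_gaussianReal (CW / n 0)
      push_cast at this
      simp only [nonpos_iff_eq_zero, one_ne_zero, if_false]
      rw [this]
      exact h.law_first i j
    · rw [if_pos (by omega)]
      exact h.law_weight ℓ h0 hℓ i j
  have hlg : ∀ ℓ ≤ L, ∀ i j, HasLaw (g ℓ i j)
      (scaledLaw (gaussianReal 0 1) (CW / n ℓ)) P := fun ℓ hℓ i j => by
    have := scaledLaw_gaussianReal (CW / n ℓ)
    push_cast at this
    rw [this]
    exact h.law_gauss ℓ hℓ i j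
  have haw : ∀ ℓ ≤ L, ∀ i j, w ℓ i j =ᵐ[P] mk (w ℓ i j) := fun ℓ hℓ i j =>
    hae _ (hlw ℓ hℓ i j).aemeasurable
  have hag : ∀ ℓ ≤ L, ∀ i j, g ℓ i j =ᵐ[P] mk (g ℓ i j) := fun ℓ hℓ i j =>
    hae _ (hlg ℓ hℓ i j).aemeasurable
  have hab : ∀ ℓ ≤ L, ∀ i, b ℓ i =ᵐ[P] mk (b ℓ i) := fun ℓ hℓ i =>
    hae _ (h.law_bias ℓ hℓ i).aemeasurable
  have epos : ∀ m ℓ i j, ℓ + 1 ≤ m →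
      mixedWeight (fun ℓ i j => mk (w ℓ i j)) (fun ℓ i j => mk (g ℓ i j)) m ℓ i j = mk (w ℓ i j) :=
    fun m ℓ i j h => by ext ω; simp only [mixedWeight, if_pos h]
  have eneg : ∀ m ℓ i j, ¬ ℓ + 1 ≤ m →
      mixedWeight (fun ℓ i j => mk (w ℓ i j)) (fun ℓ i j => mk (g ℓ i j)) m ℓ i j = mk (g ℓ i j) :=
    fun m ℓ i j h => by ext ω; simp only [mixedWeight, if_neg h]
  refine ⟨fun ℓ i j => mk (w ℓ i j), fun ℓ i j => mk (g ℓ i j), fun ℓ i => mk (b ℓ i),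
    fun m hm => ⟨fun ℓ i j => ?_, fun ℓ i => hmk _, fun ℓ hℓ i j => ?_, fun ℓ hℓ i => ?_, ?_⟩, ?_⟩
  · by_cases hℓ : ℓ + 1 ≤ m
    · rw [epos m ℓ i j hℓ]
      exact hmk _
    · rw [eneg m ℓ i j hℓ]
      exact hmk _
  · by_cases hℓm : ℓ + 1 ≤ m
    · rw [epos m ℓ i j hℓm, ← Measure.map_congr (haw ℓ hℓ i j), (hlw ℓ hℓ i j).map_eq, mixedLaw]
      simp only [hℓm, and_true]
    · rw [eneg m ℓ i j hℓm, ← Measure.map_congr (hag ℓ hℓ i j), (hlg ℓ hℓ i j).map_eq, mixedLaw]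
      simp only [hℓm, and_false, if_false]
  · rw [← Measure.map_congr (hab ℓ hℓ i), (h.law_bias ℓ hℓ i).map_eq]
  · have hind := h.indep.congr (g := Sum.elim (fun p : WeightIndex L n => mk (w p.1 p.2.1 p.2.2))
      (Sum.elim (fun p : WeightIndex L n => mk (g p.1 p.2.1 p.2.2))
        (fun p : BiasIndex L n => mk (b p.1 p.2)))) (by
        rintro (p | p | p)
        · exact haw _ (by omega) _ _
        · exact hag _ (by omega) _ _
        · exact hab _ (by omega) _)
    set e : WeightIndex L n ⊕ BiasIndex L n → WeightIndex L n ⊕ (WeightIndex L n ⊕ BiasIndex L n) :=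
      Sum.elim (fun p => if (p.1 : ℕ) + 1 ≤ m then .inl p else .inr (.inl p))
        (fun q => .inr (.inr q)) with he
    have hinj : Function.Injective e := by
      rintro (p | p) (q | q) hpq <;> simp only [he, Sum.elim_inl, Sum.elim_inr] at hpq
      · split_ifs at hpq <;> simpa using hpq
      · split_ifs at hpq
        simp at hpq
      · split_ifs at hpq
        simp at hpq
      · simpa using hpq
    convert hind.precomp hinj using 1
    ext1 (p | p)
    · by_cases hp : (p.1 : ℕ) + 1 ≤ m
      · ext ω; simp only [he, Sum.elim_inl, mixedWeight, if_pos hp]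
      · ext ω; simp only [he, Sum.elim_inl, Sum.elim_inr, mixedWeight, if_neg hp]
    · rfl
  · refine ae_all_iff.2 fun ℓ => ?_
    by_cases hℓ : ℓ ≤ L
    · have h1 := ae_all_iff.2 fun i => ae_all_iff.2 fun j => (haw ℓ hℓ i j).and (hag ℓ hℓ i j)
      have h2 := ae_all_iff.2 fun i => hab ℓ hℓ i
      filter_upwards [h1, h2] with ω k1 k2 _
      exact ⟨k1, k2⟩
    · exact .of_forall fun ω h' => absurd h' hℓ

theorem EuclideanSpace.norm_le_sum_abs {ι : Type*} [Fintype ι] (y : EuclideanSpace ℝ ι) :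
    ‖y‖ ≤ ∑ i, |y i| := by
  rw [EuclideanSpace.norm_eq]
  refine Real.sqrt_le_iff.2 ⟨Finset.sum_nonneg fun i _ => abs_nonneg _, ?_⟩
  simpa only [Real.norm_eq_abs] using
    Finset.sum_sq_le_sq_sum_of_nonneg (s := Finset.univ) (f := fun i => |y i|)
      fun i _ => abs_nonneg _

/-- Truncating a measurable version at the essential supremum makes the bound hold everywhere. -/
theorem MeasureTheory.MemLp.exists_measurable_abs_le {E : Type*} [MeasurableSpace E]
    {m : Measure E} {F : E → ℝ} (hF : MemLp F ∞ m) :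
    ∃ F1 : E → ℝ, Measurable F1 ∧ (∀ y, |F1 y| ≤ (eLpNorm F ∞ m).toReal) ∧ F =ᵐ[m] F1 := by
  set M := (eLpNorm F ∞ m).toReal with hM
  have hM0 : 0 ≤ M := ENNReal.toReal_nonneg
  refine ⟨fun y => max (-M) (min M (hF.1.mk F y)),
    measurable_const.max (measurable_const.min hF.1.stronglyMeasurable_mk.measurable),
    fun y => abs_le.2 ⟨le_max_left _ _, max_le (by linarith) (min_le_left _ _)⟩, ?_⟩
  have hle : ∀ᵐ y ∂m, |F y| ≤ M := by
    have := ae_le_eLpNormEssSup (f := F) (μ := m)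
    filter_upwards [this] with y hy
    rw [← eLpNorm_exponent_top] at hy
    have := ENNReal.toReal_mono hF.2.ne hy
    rwa [toReal_enorm, Real.norm_eq_abs] at this
  filter_upwards [hF.1.ae_eq_mk, hle] with y h1 h2
  rw [← h1, min_eq_right (abs_le.1 h2).2, max_eq_right (abs_le.1 h2).1]

theorem IsCb.abs_sub_le {E : Type*} [NormedAddCommGroup E] [InnerProductSpace ℝ E]
    [CompleteSpace E] {F : E → ℝ} (hF : IsCb 1 F) (y y' : E) :
    |F y - F y'| ≤ (⨆ z, ‖∇ F z‖) * ‖y - y'‖ := by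
  obtain ⟨hc, hb⟩ := hF
  obtain ⟨B1, h1⟩ := hb 1 le_rfl
  have hn : ∀ z, ‖∇ F z‖ = ‖fderiv ℝ F z‖ := fun z => by
    rw [gradient, LinearIsometryEquiv.norm_map]
  have hbd : BddAbove (Set.range fun z => ‖∇ F z‖) := by
    refine ⟨B1, ?_⟩
    rintro _ ⟨z, rfl⟩
    simp only [hn]
    rw [← norm_iteratedFDeriv_one]
    exact h1 z
  refine convex_univ.norm_image_sub_le_of_norm_fderiv_le (𝕜 := ℝ)
    (fun z _ => (hc.differentiable (by norm_num)) z) (fun z _ => ?_) trivial trivial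
  rw [← hn]
  exact le_ciSup hbd z

theorem switchedOutput_eq_randomLayer {Ω : Type*} (L : ℕ) (n : ℕ → ℕ) (σ : ℝ → ℝ)
    (w g : (ℓ : ℕ) → Fin (n (ℓ + 1)) → Fin (n ℓ) → Ω → ℝ)
    (b : (ℓ : ℕ) → Fin (n (ℓ + 1)) → Ω → ℝ) (x : Fin (n 0) → ℝ) (m : ℕ) (ω : Ω) :
    switchedOutput L n σ w g b x m ω
      = WithLp.toLp 2 (randomLayer n σ (mixedWeight w g m) b x L ω) := rfl

theorem mainTheorem6 (L d : ℕ) (σ : ℝ → ℝ) (hσ : IsCb 3 σ)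
    (CW cb : ℝ≥0) (hCW : 0 < CW) (hcb : 0 < cb)
    (μ : Measure ℝ) [IsProbabilityMeasure μ]
    (hμ3 : Integrable (fun t : ℝ => |t| ^ 3) μ)
    (hμ1 : ∫ t, t ∂μ = 0) (hμ2 : ∫ t, t ^ 2 ∂μ = 1) :
    ∃ C : ℝ, 0 < C ∧
      ∀ (n : ℕ → ℕ), n (L + 1) = d → (∀ ℓ ≤ L + 1, 0 < n ℓ) →
      ∀ (Ω : Type*) [MeasurableSpace Ω] (P : Measure Ω) [IsProbabilityMeasure P]
        (w g : (ℓ : ℕ) → Fin (n (ℓ + 1)) → Fin (n ℓ) → Ω → ℝ)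
        (b : (ℓ : ℕ) → Fin (n (ℓ + 1)) → Ω → ℝ),
      IsRandomInit P L n CW cb μ w g b →
      ∀ (x : Fin (n 0) → ℝ) (k : ℕ), 1 ≤ k → k ≤ L →
      ∀ F : EuclideanSpace ℝ (Fin (n (L + 1))) → ℝ,
        (MemLp F ∞ volume →
          Integrable (fun ω => F (switchedOutput L n σ w g b x (k + 1) ω)) P ∧
          Integrable (fun ω => F (switchedOutput L n σ w g b x k ω)) P ∧
          |(∫ ω, F (switchedOutput L n σ w g b x (k + 1) ω) ∂P)
              - ∫ ω, F (switchedOutput L n σ w g b x k ω) ∂P|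
            ≤ C * (eLpNorm F ∞ volume).toReal / √(n k : ℝ)) ∧
        (IsCb 1 F →
          Integrable (fun ω => F (switchedOutput L n σ w g b x (k + 1) ω)) P ∧
          Integrable (fun ω => F (switchedOutput L n σ w g b x k ω)) P ∧
          |(∫ ω, F (switchedOutput L n σ w g b x (k + 1) ω) ∂P)
              - ∫ ω, F (switchedOutput L n σ w g b x k ω) ∂P|
            ≤ C * (⨆ y, ‖∇ F y‖) / √(n k : ℝ)) := by
  have hσm : Measurable σ := hσ.1.continuous.measurable
  obtain ⟨C, hC, H⟩ := exists_bound_of_osc L d hσ CW hcb ⟨hμ1, hμ2, hμ3⟩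
  -- The factor `2` comes from the oscillation `2 * ‖F‖∞` of a bounded function; the `1` makes the
  -- constant positive.
  refine ⟨2 * C + 1, by positivity, fun n hd hn Ω _ P _ w g b hinit x k hk hkL F => ?_⟩
  obtain ⟨k, rfl⟩ : ∃ k', k = k' + 1 := ⟨k - 1, by omega⟩
  obtain ⟨w', g', b', hnet, hae⟩ := hinit.exists_measurable
  have hlayer : ∀ m, ∀ᵐ ω ∂P, randomLayer n σ (mixedWeight w g m) b x L ω
      = randomLayer n σ (mixedWeight w' g' m) b' x L ω := fun m => by
    filter_upwards [hae] with ω hω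
    refine randomLayer_congr (fun ℓ hℓ i j => ?_) fun ℓ hℓ i => (hω ℓ hℓ).2 i
    simp only [mixedWeight, ((hω ℓ hℓ).1 i j).1, ((hω ℓ hℓ).1 i j).2]
  have key : ∀ (F1 : EuclideanSpace ℝ (Fin (n (L + 1))) → ℝ) (A B : ℝ), Measurable F1 → 0 ≤ A →
      (∀ y, |F1 y| ≤ B) → (∀ y y', |F1 y - F1 y'| ≤ A * (1 + ‖y - y'‖)) → F =ᵐ[volume] F1 →
      Integrable (fun ω => F (switchedOutput L n σ w g b x (k + 1 + 1) ω)) P ∧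
      Integrable (fun ω => F (switchedOutput L n σ w g b x (k + 1) ω)) P ∧
      |(∫ ω, F (switchedOutput L n σ w g b x (k + 1 + 1) ω) ∂P)
          - ∫ ω, F (switchedOutput L n σ w g b x (k + 1) ω) ∂P|
        ≤ C * A / √(n (k + 1) : ℝ) := by
    intro F1 A B hF1 hA hB hosc hFF1
    have hG : Measurable fun y : Fin (n (L + 1)) → ℝ => F1 (WithLp.toLp 2 y) :=
      hF1.comp (WithLp.measurable_toLp 2 _)
    have hout : ∀ m, 1 ≤ m → (fun ω => F (switchedOutput L n σ w g b x m ω)) =ᵐ[P]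
        fun ω => F1 (WithLp.toLp 2 (randomLayer n σ (mixedWeight w' g' m) b' x L ω)) := by
      intro m hm
      -- The set where `F` and `F1` differ is null, and the output avoids it almost surely.
      have hnull := (PiLp.volume_preserving_toLp (Fin (n (L + 1)))).quasiMeasurePreserving.ae hFF1
      obtain ⟨N, hsub, hNm, hN0⟩ := exists_measurable_superset_of_null (ae_iff.1 hnull)
      obtain ⟨ℓ, rfl⟩ : ∃ ℓ, L = ℓ + 1 := ⟨L - 1, by omega⟩
      have hP := (hnet m hm).measure_layer_succ_eq_zero (x := x) hcb hσm le_rfl hNm hN0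
      filter_upwards [hlayer m, measure_eq_zero_iff_ae_notMem.1 hP] with ω h1 h2
      rw [switchedOutput_eq_randomLayer, h1]
      by_contra hne
      exact h2 (hsub hne)
    have hint : ∀ m, 1 ≤ m → Integrable (fun ω =>
        F1 (WithLp.toLp 2 (randomLayer n σ (mixedWeight w' g' m) b' x L ω))) P := fun m hm =>
      integrable_of_measurable_of_abs_le (hG.comp ((hnet m hm).measurable_layer hσm L))
        fun ω => hB _
    refine ⟨(hint _ (by omega)).congr (hout _ (by omega)).symm,
      (hint _ (by omega)).congr (hout _ (by omega)).symm, ?_⟩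
    rw [integral_congr_ae (hout (k + 1 + 1) (by omega)),
      integral_congr_ae (hout (k + 1) (by omega))]
    refine H n hd hn Ω P w' g' b' x k hkL (hnet _ (by omega)) (hnet _ (by omega)) _ A B hG hA
      (fun y => hB _) fun y y' => (hosc _ _).trans ?_
    gcongr
    exact EuclideanSpace.norm_le_sum_abs _
  refine ⟨fun hF => ?_, fun hF => ?_⟩
  · obtain ⟨F1, hm, hB, he⟩ := hF.exists_measurable_abs_le
    have hM : 0 ≤ (eLpNorm F ∞ volume).toReal := ENNReal.toReal_nonneg
    obtain ⟨i1, i2, hle⟩ := key F1 (2 * (eLpNorm F ∞ volume).toReal) _ hm (by positivity) hB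
      (fun y y' => by
        have h1 := abs_sub (F1 y) (F1 y')
        have h2 := mul_nonneg hM (norm_nonneg (y - y'))
        linarith [hB y, hB y']) he
    refine ⟨i1, i2, hle.trans ?_⟩
    refine div_le_div_of_nonneg_right ?_ (Real.sqrt_nonneg _)
    linarith
  · have hA : 0 ≤ ⨆ y, ‖∇ F y‖ := Real.iSup_nonneg fun y => norm_nonneg _
    obtain ⟨B0, h0⟩ := hF.2 0 (by norm_num)
    obtain ⟨i1, i2, hle⟩ := key F (⨆ y, ‖∇ F y‖) B0 hF.1.continuous.measurable hA
      (fun y => by simpa using h0 y)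
      -- The Lipschitz bound implies the oscillation bound with the same `A`; the sup norm `B0` does
      -- not enter the estimate.
      (fun y y' => (hF.abs_sub_le y y').trans (by gcongr; linarith)) (ae_eq_refl F)
    refine ⟨i1, i2, hle.trans ?_⟩
    refine div_le_div_of_nonneg_right ?_ (Real.sqrt_nonneg _)
    linarith [mul_nonneg hC hA]
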